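/- Let $\mathcal S$ be the category with objects the finite cardinals $n=\{0,\dots,n-1\}$ and morphisms all functions. It is an operadic category: for $\varphi:m\to n$ and $i\in n$ the fibre $\varphi^{-1}i$ is the finite cardinal identified with $\{a\mid \varphi(a)=i\}$ by the increasing enumeration, and for composable $\varphi,\psi$ the function $\varphi^\psi_j:(\psi\varphi)^{-1}j\to\psi^{-1}j$ is the restriction of $\varphi$. An object is trivial if it is $1$; a morphism is fibrewise trivial if all its fibres are trivial. Let $\mathrm{Coll}_{\mathcal S}$ be the category of families of sets $X=(X_n)_{n\in\mathbb N}$, with tensor product $$(X*Y)_n=\sum_{\varphi:n\to m}X_m\times\prod_{i\in m}Y_{\varphi^{-1}i},$$ whose unit $U$ is the set of trivial objects ($U_1$ a singleton, $U_n=\emptyset$ for $n\neq1$), and with structure maps $\alpha(x,\psi,y,\varphi,z)=(x,\psi\varphi,y,\varphi^\psi,z)$, $\lambda(u,\varphi,x)=x$, $\rho(x)=(x,1,R1)$, where $R1$ denotes the family of (trivial) fibres of the identity $1$. This is a skew monoidal category $(\alpha:(X*Y)*Z\to X*(Y*Z)$, $\lambda:U*X\to X$, $\rho:X\to X*U$,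 not necessarily invertible, satisfying the five coherence axioms$)$. The right normalization $\mathrm{Coll}_{\mathcal S}^U$ is the category of right modules $(M,\ r:M*U\to M)$ over the monoid $U$ (with multiplication $\lambda_U$), with unit $U$, and with tensor product $M\wedge N$ the coequalizer $p:M*N\to M\wedge N$ of $r*1$ and $(1*\lambda)\alpha:(M*U)*N\to M*N$; the action on $M\wedge N$ is the one induced by that of $N$, and the tensor product of morphisms and the structure maps are those induced by the ones of $\mathrm{Coll}_{\mathcal S}$ along the maps $p$. Let $\mathbb P$ be the category of finite cardinals and bijections, and let $[\mathbb P,\mathbf{Set}]$ be the category of symmetric collections, with the substitution product $$(X\circ Y)(n)=\int^{m}X(m)\times\int^{k_1,\dots,k_m}\mathbb P(k_1+\dots+k_m,n)\times Y(k_1)\times\dots\times Y(k_m)$$ with unit $\mathbb P(1,-)$ and the usual constraints. Then: 1. A morphism of $\mathcal S$ is fibrewise trivial if and only if it is bijective, so that the category of fibrewise trivial morphisms of $\mathcal S$ is $\mathbb P$. 2. $\mathrm{Coll}_{\mathcal S}$ is a skew monoidal category and $[\mathbb P,\mathbf{Set}]$ is a monoidal category. The right normalization $\mathrm{Coll}_{\mathcal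 S}^U$ exists and (for any choice of the coequalizers) is a genuine monoidal category: it satisfies the axioms, and all its maps $\alpha,\lambda,\rho$ are invertible. 3. There is an equivalence of categories $F:\mathrm{Coll}_{\mathcal S}^U\simeq[\mathbb P,\mathbf{Set}]$ which is a strong monoidal functor and which commutes, up to natural isomorphism, with the functors sending an object to its underlying family of sets $(X_n)_{n\in\mathbb N}$. 4. There is an equivalence from the category of monoids in $\mathrm{Coll}_{\mathcal S}^U$ to the category of symmetric operads (sequences of sets $P(n)$ with actions of the symmetric groups, an identity in $P(1)$, and associative, unital and equivariant composition maps $P(m)\times P(k_1)\times\dots\times P(k_m)\to P(k_1+\dots+k_m)$); it commutes, up to natural isomorphism, with $F$ and the forgetful functors to $[\mathbb P,\mathbf{Set}]$. -/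

import Mathlib

open CategoryTheory

universe w v u

/-! ## The category `𝒮` of finite cardinals and functions, and its fibre functors -/

/-- A finite cardinal `n`, standing for the finite set `Fin n`. These are the objects of the
skeletal category `𝒮` of finite sets. -/
@[ext]
structure FinCard : Type where
  card : ℕ

namespace FinCard

/-- Morphisms of `𝒮` are all functions. -/
instance : Category.{0} FinCard where
  Hom a b := Fin a.card → Fin b.card
  id _ := fun x => x
  comp f g := fun x => g (f x)

/-- The function underlying a morphism of `𝒮`. -/
abbrev fn {a b : FinCard} (f : a ⟶ b) : Fin a.card → Fin b.card := f

/-- The fibre of a function of finite cardinals, as a subset of its domain. -/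
def fibreSet {a b : ℕ} (φ : Fin a → Fin b) (i : Fin b) : Finset (Fin a) :=
  Finset.univ.filter (fun x => φ x = i)

/-- The increasing enumeration of a fibre. -/
def enum {a b : ℕ} (φ : Fin a → Fin b) (i : Fin b) :
    Fin (fibreSet φ i).card ≃o fibreSet φ i :=
  (fibreSet φ i).orderIsoOfFin rfl

theorem mem_fibreSet {a b : ℕ} {φ : Fin a → Fin b} {i : Fin b} {x : Fin a} :
    x ∈ fibreSet φ i ↔ φ x = i := by
  simp [fibreSet]

theorem over_w {d : FinCard} {f g : Over d} (k : f ⟶ g) (x : Fin f.left.card) :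
    fn g.hom (fn k.left x) = fn f.hom x :=
  congrFun (Over.w k) x

/-- The `i`-th component `𝒮/d ⥤ 𝒮` of the equivalence `R_d : 𝒮/d ⥤ 𝒮^d`. It sends a function
to the cardinality of its fibre over `i` (identified with that fibre by the increasing
enumeration), and a function over `d` to its restriction to the fibres. -/
def R (d : FinCard) (i : Fin d.card) : Over d ⥤ FinCard where
  obj f := ⟨(fibreSet (fn f.hom) i).card⟩
  map {f g} k := fun t =>
    (enum (fn g.hom) i).symm
      ⟨fn k.left (enum (fn f.hom) i t),
        mem_fibreSet.2 ((over_w k _).trans (mem_fibreSet.1 (enum (fn f.hom) i t).2))⟩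
  map_id f := by
    funext t
    exact OrderIso.symm_apply_apply (enum (fn f.hom) i) t
  map_comp {f g h} k l := by
    funext t
    refine congrArg (enum (fn h.hom) i).symm (Subtype.ext ?_)
    refine congrArg (fn l.left) ?_
    refine Eq.symm (congrArg Subtype.val (OrderIso.apply_symm_apply (enum (fn g.hom) i)
      ⟨fn k.left (enum (fn f.hom) i t), mem_fibreSet.2
        ((over_w k _).trans (mem_fibreSet.1 (enum (fn f.hom) i t).2))⟩))

end FinCard

/-! ## Operadic categories -/

/-- The data of an operadic category: a cardinality functor `|·| : C ⥤ 𝒮`, and functors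
`R_c : C/c ⥤ C^|c|` (given by their components `R_c,i`), which strictly commute with cardinality. -/
class FibreStructure (C : Type) [Category.{0} C] where
  card : C ⥤ FinCard
  R : ∀ (c : C) (_ : Fin (card.obj c).card), Over c ⥤ C
  R_card : ∀ (c : C) (i : Fin (card.obj c).card),
    R c i ⋙ card = Over.post card ⋙ FinCard.R (card.obj c) i

section Operadic

variable {C : Type} [Category.{0} C] [FibreStructure C]

/-- The cardinality `|c|`, as a natural number. -/
abbrev cardOf (c : C) : ℕ := ((FibreStructure.card (C := C)).obj c).card

/-- The underlying function of the cardinality of a morphism. -/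
abbrev cardMap {c d : C} (φ : c ⟶ d) : Fin (cardOf c) → Fin (cardOf d) :=
  (FibreStructure.card (C := C)).map φ

/-- The fibre `ψ⁻¹ i` of a morphism `ψ : c ⟶ d` at `i ∈ |d|`. -/
abbrev fibre {c d : C} (ψ : c ⟶ d) (i : Fin (cardOf d)) : C :=
  (FibreStructure.R d i).obj (Over.mk ψ)

/-- The morphism `φ^ψ_i : (ψφ)⁻¹ i ⟶ ψ⁻¹ i` induced by `φ` on fibres. -/
abbrev fibreMap {b c d : C} (φ : b ⟶ c) (ψ : c ⟶ d) (i : Fin (cardOf d)) :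
    fibre (φ ≫ ψ) i ⟶ fibre ψ i :=
  (FibreStructure.R d i).map (Over.homMk φ : Over.mk (φ ≫ ψ) ⟶ Over.mk ψ)

/-- The strict equality `|ψ⁻¹ j| = |ψ|⁻¹ j`. -/
theorem card_fibre {c d : C} (ψ : c ⟶ d) (j : Fin (cardOf d)) :
    cardOf (fibre ψ j) = (FinCard.fibreSet (cardMap ψ) j).card :=
  congrArg FinCard.card (Functor.congr_obj (FibreStructure.R_card d j) (Over.mk ψ))

/-- The inclusion `|ψ⁻¹ j| → |c|` which, for varying `j`, gives the canonical bijection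
`∑ j, |ψ⁻¹ j| ≅ |c|`. -/
def fibreIncl {c d : C} (ψ : c ⟶ d) (j : Fin (cardOf d)) (i : Fin (cardOf (fibre ψ j))) :
    Fin (cardOf c) :=
  FinCard.enum (cardMap ψ) j (Fin.cast (card_fibre ψ j) i)

/-- An object `u` is trivial if `|u| = 1` and `R_u` is the domain functor. -/
def IsTrivialObj (u : C) : Prop :=
  cardOf u = 1 ∧ ∀ i : Fin (cardOf u), FibreStructure.R u i = Over.forget u

/-- A morphism is fibrewise trivial if all its fibres are trivial. -/
def FibrewiseTrivial {c d : C} (φ : c ⟶ d) : Prop :=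
  ∀ i : Fin (cardOf d), IsTrivialObj (fibre φ i)

end Operadic

/-- An operadic category (in the generalized sense): fibres of identities are trivial, and the
double slice condition holds: for `ψ : c ⟶ d`, the functor
`(C/d)/ψ ⥤ C^|d| / R ψ = ∏ⱼ C/ψ⁻¹j ⥤ ∏ⱼ C^|ψ⁻¹j| = C^|c|` is
`R_c` preceded by the canonical isomorphism `(C/d)/ψ ≅ C/c`. -/
class OperadicCategory (C : Type) [Category.{0} C] extends FibreStructure C where
  fibrewiseTrivial_id : ∀ c : C, FibrewiseTrivial (𝟙 c)
  double_slice : ∀ {c d : C} (ψ : c ⟶ d) (j : Fin (cardOf d)) (i : Fin (cardOf (fibre ψ j))),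
    Over.post (X := Over.mk ψ) (FibreStructure.R d j) ⋙ FibreStructure.R (fibre ψ j) i =
      Over.iteratedSliceForward (Over.mk ψ) ⋙ FibreStructure.R c (fibreIncl ψ j i)

/-- The object part of the double slice condition. -/
theorem fibre_fibreMap {C : Type} [Category.{0} C] [OperadicCategory C] {b c d : C}
    (φ : b ⟶ c) (ψ : c ⟶ d) (j : Fin (cardOf d)) (i : Fin (cardOf (fibre ψ j))) :
    fibre (fibreMap φ ψ j) i = fibre φ (fibreIncl ψ j i) :=
  Functor.congr_obj (OperadicCategory.double_slice ψ j i)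
    (Over.mk (Over.homMk φ : Over.mk (φ ≫ ψ) ⟶ Over.mk ψ))

namespace FinCard

instance : FibreStructure FinCard where
  card := 𝟭 FinCard
  R := FinCard.R
  R_card _ _ := rfl

/-- Any two strictly increasing enumerations of the same subset agree. -/
theorem strictMono_unique {k l n : ℕ} {f : Fin k → Fin n} {g : Fin l → Fin n}
    (hf : StrictMono f) (hg : StrictMono g) (h : Set.range f = Set.range g) :
    ∃ e : k = l, ∀ t, f t = g (Fin.cast e t) := by
  have e : k = l := by
    have h1 := Set.card_range_of_injective hf.injective
    have h2 := Set.card_range_of_injective hg.injective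
    simp only [Fintype.card_fin] at h1 h2
    rw [← h1, ← h2]
    exact Fintype.card_congr (Equiv.setCongr h)
  subst e
  exact ⟨rfl, fun t => congrFun ((hf.range_inj hg).1 h) t⟩

/-- The inclusion of the fibre over `i` into the domain. -/
def incl {d : FinCard} (f : Over d) (i : Fin d.card) (t : Fin ((R d i).obj f).card) :
    Fin f.left.card :=
  enum (fn f.hom) i t

theorem incl_strictMono {d : FinCard} (f : Over d) (i : Fin d.card) : StrictMono (incl f i) :=
  fun _ _ h => (enum (fn f.hom) i).strictMono h

theorem range_incl {d : FinCard} (f : Over d) (i : Fin d.card) :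
    Set.range (incl f i) = {x | fn f.hom x = i} := by
  ext x
  constructor
  · rintro ⟨t, rfl⟩
    exact mem_fibreSet.1 (enum (fn f.hom) i t).2
  · intro hx
    exact ⟨(enum (fn f.hom) i).symm ⟨x, mem_fibreSet.2 hx⟩,
      congrArg Subtype.val (OrderIso.apply_symm_apply (enum (fn f.hom) i) _)⟩

theorem incl_map {d : FinCard} {f g : Over d} (k : f ⟶ g) (i : Fin d.card)
    (t : Fin ((R d i).obj f).card) :
    incl g i (fn ((R d i).map k) t) = fn k.left (incl f i t) :=
  congrArg Subtype.val (OrderIso.apply_symm_apply (enum (fn g.hom) i) _)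

theorem functor_ext {D : Type u} [Category.{v} D] {F G : D ⥤ FinCard}
    (h : ∀ X, (F.obj X).card = (G.obj X).card)
    (h' : ∀ {X Y : D} (f : X ⟶ Y) (t : Fin (F.obj X).card),
      Fin.cast (h Y) (fn (F.map f) t) = fn (G.map f) (Fin.cast (h X) t)) : F = G := by
  have key : ∀ {a b a' b' : FinCard} (ha : a.card = a'.card) (hb : b.card = b'.card)
      (p : a ⟶ b) (q : a' ⟶ b')
      (_ : ∀ t, Fin.cast hb (fn p t) = fn q (Fin.cast ha t)), p ≍ q := by
    rintro ⟨a⟩ ⟨b⟩ ⟨a'⟩ ⟨b'⟩ ha hb p q hpq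
    dsimp only at ha hb
    subst ha hb
    exact heq_of_eq (funext hpq)
  exact Functor.hext (fun X => FinCard.ext (h X)) (fun X Y f => key (h X) (h Y) _ _ (h' f))

theorem isTrivialObj_of_card {u : FinCard} (h : u.card = 1) : IsTrivialObj u := by
  refine ⟨h, fun (i : Fin u.card) => ?_⟩
  have all : ∀ x : Fin u.card, x = i := fun x => Fin.ext (by have := x.2; have := i.2; omega)
  have key : ∀ f : Over u, ∃ e : ((R u i).obj f).card = f.left.card,
      ∀ t, incl f i t = Fin.cast e t := fun f =>
    strictMono_unique (g := fun x => x) (incl_strictMono f i) strictMono_id (by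
      rw [range_incl]
      ext x
      simp [all])
  refine functor_ext (fun f => (key f).1) (fun {f g} k t => ?_)
  refine ((key g).2 _).symm.trans ((incl_map k i t).trans ?_)
  exact congrArg (fn k.left) ((key f).2 t)

theorem fibreSet_id_card {a : ℕ} (i : Fin a) : (fibreSet (fun x : Fin a => x) i).card = 1 := by
  simp [fibreSet, Finset.filter_eq']

theorem double_slice {c d : FinCard} (ψ : c ⟶ d) (j : Fin d.card)
    (i : Fin ((R d j).obj (Over.mk ψ)).card) :
    Over.post (X := Over.mk ψ) (R d j) ⋙ R ((R d j).obj (Over.mk ψ)) i =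
      Over.iteratedSliceForward (Over.mk ψ) ⋙ R c (incl (Over.mk ψ) j i) := by
  have key : ∀ f : Over (Over.mk ψ),
      ∃ e : ((R _ i).obj ((Over.post (R d j)).obj f)).card =
          ((R c (incl (Over.mk ψ) j i)).obj
            ((Over.iteratedSliceForward (Over.mk ψ)).obj f)).card,
        ∀ t, incl f.left j (incl ((Over.post (R d j)).obj f) i t) =
          incl ((Over.iteratedSliceForward (Over.mk ψ)).obj f) (incl (Over.mk ψ) j i)
            (Fin.cast e t) := fun f =>
    strictMono_unique
      ((incl_strictMono f.left j).comp (incl_strictMono ((Over.post (R d j)).obj f) i))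
      (incl_strictMono ((Over.iteratedSliceForward (Over.mk ψ)).obj f) _) (by
        refine Eq.trans ?_ (range_incl ((Over.iteratedSliceForward (Over.mk ψ)).obj f) _).symm
        refine Set.ext fun (x : Fin f.left.left.card) => ⟨?_, ?_⟩
        · rintro ⟨t, rfl⟩
          have ht := (range_incl ((Over.post (R d j)).obj f) i).subset ⟨t, rfl⟩
          exact (incl_map f.hom j _).symm.trans (congrArg (incl (Over.mk ψ) j) ht)
        · intro (hx : fn f.hom.left x = incl (Over.mk ψ) j i)
          have hx' : fn f.left.hom x = j := by
            refine (over_w f.hom x).symm.trans ?_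
            rw [hx]
            exact (range_incl (Over.mk ψ) j).subset ⟨i, rfl⟩
          obtain ⟨y, rfl⟩ := (range_incl f.left j).superset hx'
          have hy := (incl_strictMono (Over.mk ψ) j).injective ((incl_map f.hom j y).trans hx)
          obtain ⟨t, rfl⟩ := (range_incl ((Over.post (R d j)).obj f) i).superset hy
          exact ⟨t, rfl⟩)
  refine functor_ext (fun f => (key f).1) (fun {f g} k t => ?_)
  refine (incl_strictMono ((Over.iteratedSliceForward (Over.mk ψ)).obj g)
    (incl (Over.mk ψ) j i)).injective ?_
  refine ((key g).2 _).symm.trans ?_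
  refine (congrArg (incl g.left j) (incl_map ((Over.post (R d j)).map k) i t)).trans ?_
  refine (incl_map k.left j _).trans ?_
  refine (congrArg (fn k.left.left) ((key f).2 t)).trans ?_
  exact (incl_map ((Over.iteratedSliceForward (Over.mk ψ)).map k) (incl (Over.mk ψ) j i) _).symm

/-- The category `𝒮` is itself operadic, with the identity as cardinality functor. -/
instance : OperadicCategory FinCard where
  fibrewiseTrivial_id _ i := isTrivialObj_of_card (fibreSet_id_card i)
  double_slice ψ j i := double_slice ψ j i

end FinCard

/-! ## Skew monoidal categories -/

/-- The data of a skew monoidal category: a tensor product functor, a unit `U`, and constraint maps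
`α : (X * Y) * Z ⟶ X * (Y * Z)`, `λ : U * X ⟶ X`, `ρ : X ⟶ X * U`. -/
structure SkewMonoidalStruct (E : Type u) [Category.{v} E] where
  tensorObj : E → E → E
  tensorHom : ∀ {X X' Y Y' : E}, (X ⟶ X') → (Y ⟶ Y') → (tensorObj X Y ⟶ tensorObj X' Y')
  tensor_id : ∀ X Y : E, tensorHom (𝟙 X) (𝟙 Y) = 𝟙 (tensorObj X Y)
  tensor_comp : ∀ {X X' X'' Y Y' Y'' : E} (f : X ⟶ X') (f' : X' ⟶ X'') (g : Y ⟶ Y')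
    (g' : Y' ⟶ Y''), tensorHom (f ≫ f') (g ≫ g') = tensorHom f g ≫ tensorHom f' g'
  unit : E
  assoc : ∀ X Y Z : E, tensorObj (tensorObj X Y) Z ⟶ tensorObj X (tensorObj Y Z)
  left : ∀ X : E, tensorObj unit X ⟶ X
  right : ∀ X : E, X ⟶ tensorObj X unit

namespace SkewMonoidalStruct

variable {E : Type u} [Category.{v} E]

/-- The laws of a skew monoidal category: naturality of the constraints, and the five coherence
axioms. -/
structure IsSkewMonoidal (D : SkewMonoidalStruct E) : Prop where
  assoc_natural : ∀ {X X' Y Y' Z Z' : E} (f : X ⟶ X') (g : Y ⟶ Y') (h : Z ⟶ Z'),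
    D.tensorHom (D.tensorHom f g) h ≫ D.assoc X' Y' Z' =
      D.assoc X Y Z ≫ D.tensorHom f (D.tensorHom g h)
  left_natural : ∀ {X X' : E} (f : X ⟶ X'),
    D.tensorHom (𝟙 D.unit) f ≫ D.left X' = D.left X ≫ f
  right_natural : ∀ {X X' : E} (f : X ⟶ X'),
    D.right X ≫ D.tensorHom f (𝟙 D.unit) = f ≫ D.right X'
  right_left : D.right D.unit ≫ D.left D.unit = 𝟙 D.unit
  assoc_left : ∀ X Y : E,
    D.assoc D.unit X Y ≫ D.left (D.tensorObj X Y) = D.tensorHom (D.left X) (𝟙 Y)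
  right_assoc : ∀ X Y : E,
    D.right (D.tensorObj X Y) ≫ D.assoc X Y D.unit = D.tensorHom (𝟙 X) (D.right Y)
  right_assoc_left : ∀ X Y : E,
    D.tensorHom (D.right X) (𝟙 Y) ≫ D.assoc X D.unit Y ≫ D.tensorHom (𝟙 X) (D.left Y) =
      𝟙 (D.tensorObj X Y)
  pentagon : ∀ W X Y Z : E,
    D.tensorHom (D.assoc W X Y) (𝟙 Z) ≫ D.assoc W (D.tensorObj X Y) Z ≫
        D.tensorHom (𝟙 W) (D.assoc X Y Z) =
      D.assoc (D.tensorObj W X) Y Z ≫ D.assoc W X (D.tensorObj Y Z)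

/-- A skew monoidal category is a (genuine) monoidal category when all three constraints are
invertible. -/
structure IsMonoidal (D : SkewMonoidalStruct E) : Prop extends IsSkewMonoidal D where
  isIso_assoc : ∀ X Y Z : E, IsIso (D.assoc X Y Z)
  isIso_left : ∀ X : E, IsIso (D.left X)
  isIso_right : ∀ X : E, IsIso (D.right X)

/-- The monoidal category (in the usual sense) given by a skew monoidal category all of whose
constraints are invertible; its right unitor is the inverse of `ρ`. -/
@[reducible]
noncomputable def IsMonoidal.monoidalCategory {D : SkewMonoidalStruct E} (h : D.IsMonoidal) :
    MonoidalCategory E :=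
  letI : MonoidalCategoryStruct E :=
    { tensorObj := D.tensorObj
      whiskerLeft := fun X _ _ f => D.tensorHom (𝟙 X) f
      whiskerRight := fun f Y => D.tensorHom f (𝟙 Y)
      tensorHom := fun f g => D.tensorHom f g
      tensorUnit := D.unit
      associator := fun X Y Z => @asIso _ _ _ _ (D.assoc X Y Z) (h.isIso_assoc X Y Z)
      leftUnitor := fun X => @asIso _ _ _ _ (D.left X) (h.isIso_left X)
      rightUnitor := fun X => (@asIso _ _ _ _ (D.right X) (h.isIso_right X)).symm }
  MonoidalCategory.ofTensorHom
    (id_tensorHom_id := D.tensor_id)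
    (id_tensorHom := fun _ _ _ _ => rfl)
    (tensorHom_id := fun _ _ => rfl)
    (tensorHom_comp_tensorHom := fun f₁ f₂ g₁ g₂ => (D.tensor_comp f₁ g₁ f₂ g₂).symm)
    (associator_naturality := fun f g k => h.assoc_natural f g k)
    (leftUnitor_naturality := fun f => h.left_natural f)
    (rightUnitor_naturality := fun {X Y} f => by
      have := h.isIso_right X
      have := h.isIso_right Y
      change D.tensorHom f (𝟙 D.unit) ≫ inv (D.right Y) = inv (D.right X) ≫ f
      rw [IsIso.comp_inv_eq, Category.assoc, IsIso.eq_inv_comp]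
      exact h.right_natural f)
    (pentagon := fun W X Y Z => h.pentagon W X Y Z)
    (triangle := fun X Y => by
      have := h.isIso_right X
      change D.assoc X D.unit Y ≫ D.tensorHom (𝟙 X) (D.left Y) =
        D.tensorHom (inv (D.right X)) (𝟙 Y)
      have h1 : D.tensorHom (inv (D.right X)) (𝟙 Y) ≫ D.tensorHom (D.right X) (𝟙 Y) =
          𝟙 _ := by
        rw [← D.tensor_comp, IsIso.inv_hom_id, Category.comp_id, D.tensor_id]
      have h2 := congrArg (D.tensorHom (inv (D.right X)) (𝟙 Y) ≫ ·) (h.right_assoc_left X Y)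
      simpa only [← Category.assoc, h1, Category.id_comp, Category.comp_id] using h2)

/-! ### Right normalization -/

/-- A right module over the unit `U` of a skew monoidal category, `U` being a monoid with
multiplication `λ : U * U ⟶ U` and identity unit. -/
structure UnitModule (D : SkewMonoidalStruct E) where
  X : E
  act : D.tensorObj X D.unit ⟶ X
  act_act : D.tensorHom act (𝟙 D.unit) ≫ act =
    D.assoc X D.unit D.unit ≫ D.tensorHom (𝟙 X) (D.left D.unit) ≫ act
  right_act : D.right X ≫ act = 𝟙 X

/-- Homomorphisms of `U`-modules. -/
@[ext]
structure UnitModule.Hom {D : SkewMonoidalStruct E} (M N : UnitModule D) where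
  hom : M.X ⟶ N.X
  act_hom : M.act ≫ hom = D.tensorHom hom (𝟙 D.unit) ≫ N.act

instance UnitModule.category (D : SkewMonoidalStruct E) : Category (UnitModule D) where
  Hom := UnitModule.Hom
  id M := ⟨𝟙 M.X, by rw [D.tensor_id, Category.comp_id, Category.id_comp]⟩
  comp f g := ⟨f.hom ≫ g.hom, by
    rw [← Category.assoc, f.act_hom, Category.assoc, g.act_hom, ← Category.assoc,
      ← D.tensor_comp, Category.comp_id]⟩

/-- The functor sending a `U`-module to its underlying object. -/
def UnitModule.forget (D : SkewMonoidalStruct E) : UnitModule D ⥤ E where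
  obj M := M.X
  map f := f.hom

/-- The unit `U`, as a module over itself. -/
def unitModule (D : SkewMonoidalStruct E) (h : D.IsSkewMonoidal) : UnitModule D where
  X := D.unit
  act := D.left D.unit
  act_act := by rw [h.left_natural, ← Category.assoc, h.assoc_left]
  right_act := h.right_left

/-- The right normalization `E^U` of a skew monoidal category `E`, for a choice of the coequalizers
involved. Its underlying category is the category of `U`-modules. The tensor product `M ∧ N` is the
coequalizer `p : M * N ⟶ M ∧ N` of `act * 1` and `(1 * λ) ∘ α : (M * U) * N ⟶ M * N`, with the
action induced by that of `N`; the unit is `U`; and the remaining structure is the one induced from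
`E` along the maps `p`. When tensoring on the right preserves the coequalizers, the maps `p` and
`p * 1` are epimorphisms, so that all the structure is determined by the chosen coequalizers. -/
structure RightNormalization (D : SkewMonoidalStruct E) (h : D.IsSkewMonoidal) where
  tensorObj : UnitModule D → UnitModule D → UnitModule D
  p : ∀ M N : UnitModule D, D.tensorObj M.X N.X ⟶ (tensorObj M N).X
  p_condition : ∀ M N : UnitModule D,
    D.tensorHom M.act (𝟙 N.X) ≫ p M N =
      (D.assoc M.X D.unit N.X ≫ D.tensorHom (𝟙 M.X) (D.left N.X)) ≫ p M N
  p_isCoequalizer : ∀ M N : UnitModule D,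
    Nonempty (Limits.IsColimit (Limits.Cofork.ofπ (p M N) (p_condition M N)))
  p_act : ∀ M N : UnitModule D,
    D.tensorHom (p M N) (𝟙 D.unit) ≫ (tensorObj M N).act =
      D.assoc M.X N.X D.unit ≫ D.tensorHom (𝟙 M.X) N.act ≫ p M N
  tensorHom : ∀ {M M' N N' : UnitModule D}, (M ⟶ M') → (N ⟶ N') →
    (tensorObj M N ⟶ tensorObj M' N')
  p_tensorHom : ∀ {M M' N N' : UnitModule D} (f : M ⟶ M') (g : N ⟶ N'),
    p M N ≫ (tensorHom f g).hom = D.tensorHom f.hom g.hom ≫ p M' N'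
  assoc : ∀ M N K : UnitModule D,
    tensorObj (tensorObj M N) K ⟶ tensorObj M (tensorObj N K)
  p_assoc : ∀ M N K : UnitModule D,
    D.tensorHom (p M N) (𝟙 K.X) ≫ p (tensorObj M N) K ≫ (assoc M N K).hom =
      D.assoc M.X N.X K.X ≫ D.tensorHom (𝟙 M.X) (p N K) ≫ p M (tensorObj N K)
  left : ∀ M : UnitModule D, tensorObj (D.unitModule h) M ⟶ M
  p_left : ∀ M : UnitModule D, p (D.unitModule h) M ≫ (left M).hom = D.left M.X
  right : ∀ M : UnitModule D, M ⟶ tensorObj M (D.unitModule h)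
  right_eq : ∀ M : UnitModule D, (right M).hom = D.right M.X ≫ p M (D.unitModule h)

namespace RightNormalization

variable {D : SkewMonoidalStruct E} {h : D.IsSkewMonoidal} (N : RightNormalization D h)

theorem p_cancel {M K : UnitModule D} {Z : E} {f g : (N.tensorObj M K).X ⟶ Z}
    (w : N.p M K ≫ f = N.p M K ≫ g) : f = g :=
  (N.p_isCoequalizer M K).elim fun c => Limits.Cofork.IsColimit.hom_ext c w

/-- The skew monoidal structure on the category of `U`-modules. -/
def toSkewMonoidalStruct : SkewMonoidalStruct (UnitModule D) where
  tensorObj := N.tensorObj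
  tensorHom f g := N.tensorHom f g
  tensor_id M K := UnitModule.Hom.ext <| N.p_cancel <| by
    rw [N.p_tensorHom]
    change D.tensorHom (𝟙 M.X) (𝟙 K.X) ≫ _ = _ ≫ 𝟙 _
    rw [D.tensor_id, Category.id_comp, Category.comp_id]
  tensor_comp f f' g g' := UnitModule.Hom.ext <| N.p_cancel <| by
    rw [N.p_tensorHom]
    change D.tensorHom (f.hom ≫ f'.hom) (g.hom ≫ g'.hom) ≫ _ =
      _ ≫ (N.tensorHom f g).hom ≫ (N.tensorHom f' g').hom
    rw [← Category.assoc, N.p_tensorHom, Category.assoc, N.p_tensorHom, D.tensor_comp,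
      Category.assoc]
  unit := D.unitModule h
  assoc := N.assoc
  left := N.left
  right := N.right

end RightNormalization

end SkewMonoidalStruct

/-! ## Collections over an operadic category -/

section Coll

variable {C : Type} [Category.{0} C] [OperadicCategory C]

/-- `(X * Y)_c = ∑ (φ : c ⟶ d), X_d × ∏ (i ∈ |d|), Y_{φ⁻¹ i}`. -/
@[ext]
structure CollTensor (X Y : C → Type w) (c : C) : Type w where
  cod : C
  hom : c ⟶ cod
  outer : X cod
  inner : ∀ i : Fin (cardOf cod), Y (fibre hom i)

/-- The fibre of a morphism with trivial codomain is its domain. -/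
theorem fibre_of_isTrivialObj {c u : C} (φ : c ⟶ u) (hu : IsTrivialObj u)
    (i : Fin (cardOf u)) : fibre φ i = c :=
  Functor.congr_obj (hu.2 i) (Over.mk φ)

variable (C) in
/-- The skew monoidal category `Coll_C` of collections (families of sets indexed by the objects
of `C`), with
`α (x, ψ, y, φ, z) = (x, ψφ, y, φ^ψ, z)`, `λ (u, φ, x) = x` and `ρ x = (x, 1, R 1)`. The unit is
the set of trivial objects. -/
def Coll : SkewMonoidalStruct (C → Type w) where
  tensorObj X Y := fun c => CollTensor X Y c
  tensorHom f g := fun _ => ↾fun a =>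
    { cod := a.cod, hom := a.hom, outer := f _ a.outer, inner := fun i => g _ (a.inner i) }
  tensor_id _ _ := rfl
  tensor_comp _ _ _ _ := rfl
  unit := fun c => ULift.{w} (PLift (IsTrivialObj c))
  assoc _ _ Z := fun _ => ↾fun a =>
    { cod := a.outer.cod
      hom := a.hom ≫ a.outer.hom
      outer := a.outer.outer
      inner := fun j =>
        { cod := fibre a.outer.hom j
          hom := fibreMap a.hom a.outer.hom j
          outer := a.outer.inner j
          inner := fun i =>
            cast (congrArg Z (fibre_fibreMap a.hom a.outer.hom j i).symm)
              (a.inner (fibreIncl a.outer.hom j i)) } }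
  left X := fun _ => ↾fun a =>
    cast (congrArg X (fibre_of_isTrivialObj a.hom a.outer.down.down _))
      (a.inner (Fin.cast a.outer.down.down.1.symm 0))
  right _ := fun c => ↾fun x =>
    { cod := c
      hom := 𝟙 c
      outer := x
      inner := fun i => ⟨⟨OperadicCategory.fibrewiseTrivial_id c i⟩⟩ }

end Coll

/-! ## Symmetric collections and the substitution product -/

/-- The objects of the category `ℙ` of finite cardinals and bijections. -/
structure FinPerm : Type where
  card : ℕ

/-- Morphisms of `ℙ` are the bijections. -/
instance : Category.{0} FinPerm where
  Hom a b := Fin a.card ≃ Fin b.card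
  id _ := Equiv.refl _
  comp f g := f.trans g

/-- The category `[ℙ, Set]` of symmetric collections: sequences of sets with actions of the
symmetric groups. -/
abbrev SymColl : Type (w + 1) := FinPerm ⥤ Type w

namespace SymColl

/-- The set `X n`, for a symmetric collection `X`. -/
abbrev level (X : SymColl.{w}) (n : ℕ) : Type w := X.obj ⟨n⟩

/-- The action of a bijection of finite cardinals. -/
def act (X : SymColl.{w}) {a b : ℕ} (σ : Fin a ≃ Fin b) (x : X.level a) : X.level b :=
  X.map (show (⟨a⟩ : FinPerm) ⟶ ⟨b⟩ from σ) x

theorem act_refl (X : SymColl.{w}) {a : ℕ} (x : X.level a) : X.act (Equiv.refl _) x = x :=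
  congrArg (fun f => f x) (X.map_id ⟨a⟩)

theorem act_trans (X : SymColl.{w}) {a b c : ℕ} (σ : Fin a ≃ Fin b) (τ : Fin b ≃ Fin c)
    (x : X.level a) : X.act (σ.trans τ) x = X.act τ (X.act σ x) :=
  congrArg (fun f => f x)
    (X.map_comp (show (⟨a⟩ : FinPerm) ⟶ ⟨b⟩ from σ) (show (⟨b⟩ : FinPerm) ⟶ ⟨c⟩ from τ))

theorem act_app {X Y : SymColl.{w}} (f : X ⟶ Y) {a b : ℕ} (σ : Fin a ≃ Fin b) (x : X.level a) :
    f.app ⟨b⟩ (X.act σ x) = Y.act σ (f.app ⟨a⟩ x) :=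
  congrArg (fun g => g x) (f.naturality (show (⟨a⟩ : FinPerm) ⟶ ⟨b⟩ from σ))

/-- A representative of an element of
`(X ∘ Y) n = ∫^m X m × Y^{⊗ m} n = ∫^{m, k₁, …, k_m} X m × ∏ᵢ Y (kᵢ) × ℙ (k₁ + ⋯ + k_m, n)`,
where `Y^{⊗ m}` is the `m`-fold Day convolution power. -/
structure SubstRep (X Y : SymColl.{w}) (n : ℕ) : Type w where
  m : ℕ
  k : Fin m → ℕ
  shuffle : (Σ i, Fin (k i)) ≃ Fin n
  outer : X.level m
  inner : ∀ i, Y.level (k i)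

/-- Two representatives define the same element of the coend when they differ by a bijection of the
index sets `Fin m` and bijections of the sets `Fin (k i)`. -/
def SubstRep.Rel {X Y : SymColl.{w}} {n : ℕ} (a b : SubstRep X Y n) : Prop :=
  ∃ (π : Fin a.m ≃ Fin b.m) (τ : ∀ i, Fin (a.k i) ≃ Fin (b.k (π i))),
    X.act π a.outer = b.outer ∧ (∀ i, Y.act (τ i) (a.inner i) = b.inner (π i)) ∧
      ∀ i t, b.shuffle ⟨π i, τ i t⟩ = a.shuffle ⟨i, t⟩

/-- The substitution product `X ∘ Y` of symmetric collections. -/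
def subst (X Y : SymColl.{w}) : SymColl.{w} where
  obj n := Quot (SubstRep.Rel (X := X) (Y := Y) (n := n.card))
  map {n n'} σ := ↾(Quot.map
    (fun a => { a with shuffle := a.shuffle.trans (show Fin n.card ≃ Fin n'.card from σ) })
    (by
      rintro a b ⟨π, τ, h1, h2, h3⟩
      exact ⟨π, τ, h1, h2, fun i t => congrArg (show Fin n.card ≃ Fin n'.card from σ) (h3 i t)⟩))
  map_id n := by
    ext ⟨a⟩
    rfl
  map_comp σ τ := by
    ext ⟨a⟩
    rfl

/-- The element of `X ∘ Y` with a given representative. -/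
def subst.mk {X Y : SymColl.{w}} {n : ℕ} (a : SubstRep X Y n) : (subst X Y).level n :=
  Quot.mk _ a

theorem subst.sound {X Y : SymColl.{w}} {n : ℕ} {a b : SubstRep X Y n} (h : a.Rel b) :
    subst.mk a = subst.mk b :=
  Quot.sound h

theorem subst.act_mk {X Y : SymColl.{w}} {n n' : ℕ} (σ : Fin n ≃ Fin n') (a : SubstRep X Y n) :
    (subst X Y).act σ (subst.mk a) = subst.mk { a with shuffle := a.shuffle.trans σ } :=
  rfl

/-- Functoriality of the substitution product. -/
def substMap {X X' Y Y' : SymColl.{w}} (f : X ⟶ X') (g : Y ⟶ Y') : subst X Y ⟶ subst X' Y' where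
  app n := ↾(Quot.map
    (fun a =>
      { m := a.m, k := a.k, shuffle := a.shuffle
        outer := f.app _ a.outer, inner := fun i => g.app _ (a.inner i) })
    (by
      rintro a b ⟨π, τ, h1, h2, h3⟩
      refine ⟨π, τ, ?_, fun i => ?_, h3⟩
      · exact (act_app f π _).symm.trans (congrArg _ h1)
      · exact (act_app g (τ i) _).symm.trans (congrArg _ (h2 i))))
  naturality n n' σ := by
    ext ⟨a⟩
    rfl

/-- The unit for substitution, the representable `ℙ (1, -)`. -/
def substUnit : SymColl.{w} where
  obj n := ULift.{w} (Fin 1 ≃ Fin n.card)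
  map {n n'} σ := ↾fun u => ⟨u.down.trans (show Fin n.card ≃ Fin n'.card from σ)⟩

/-- The bijection with a block of a one-element family of blocks. -/
noncomputable def blockEquiv {m : ℕ} (k : Fin m → ℕ) (u : Fin 1 ≃ Fin m) :
    Fin (k (u 0)) ≃ (Σ i, Fin (k i)) :=
  Equiv.ofBijective (fun t => ⟨u 0, t⟩) ⟨fun s t h => by simpa using h, by
    rintro ⟨i, t⟩
    obtain ⟨z, rfl⟩ := u.surjective i
    obtain rfl : z = 0 := Subsingleton.elim _ _
    exact ⟨t, rfl⟩⟩

theorem blockEquiv_apply {m : ℕ} (k : Fin m → ℕ) (u : Fin 1 ≃ Fin m) (t : Fin (k (u 0))) :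
    blockEquiv k u t = ⟨u 0, t⟩ :=
  rfl

/-- `λ : ℙ (1, -) ∘ X ⟶ X`. -/
noncomputable def substLeft (X : SymColl.{w}) : subst substUnit X ⟶ X where
  app n := ↾(Quot.lift
    (fun a => X.act ((blockEquiv a.k a.outer.down).trans a.shuffle) (a.inner (a.outer.down 0)))
    (by
      rintro a ⟨m, k, e, x, y⟩ ⟨π, τ, h1, h2, h3⟩
      dsimp only at π τ h1 h2 h3
      subst h1
      change X.act _ _ = X.act ((blockEquiv k (a.outer.down.trans π)).trans e)
        (y (π (a.outer.down 0)))
      rw [← h2]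
      refine Eq.trans ?_ (act_trans X (τ (a.outer.down 0)) _ _)
      refine congrArg (fun σ => X.act σ (a.inner (a.outer.down 0))) ?_
      exact Equiv.ext fun t => (h3 _ t).symm))
  naturality n n' σ := by
    ext ⟨a⟩
    exact act_trans X ((blockEquiv a.k a.outer.down).trans a.shuffle)
      (show Fin n.card ≃ Fin n'.card from σ) (a.inner (a.outer.down 0))

/-- `ρ : X ⟶ X ∘ ℙ (1, -)`. -/
def substRight (X : SymColl.{w}) : X ⟶ subst X substUnit where
  app n := ↾fun x => subst.mk
    { m := n.card
      k := fun _ => 1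
      shuffle := Equiv.sigmaUnique (Fin n.card) (fun _ => Fin 1)
      outer := x
      inner := fun _ => ⟨Equiv.refl _⟩ }
  naturality n n' σ := by
    ext x
    refine (subst.sound ?_).symm
    refine ⟨show Fin n.card ≃ Fin n'.card from σ, fun _ => Equiv.refl _, rfl, fun _ => rfl,
      fun i t => rfl⟩

/-- The bijection assembling the blocks of a composite: given blocks `Fin (k i)` of `Fin p` and
blocks `Fin (l a)` of `Fin n`, the sets `Fin (∑ t, l (e (i, t)))` are blocks of `Fin n`. -/
def assocShuffle {m p n : ℕ} {k : Fin m → ℕ} (e : (Σ i, Fin (k i)) ≃ Fin p) {l : Fin p → ℕ}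
    (f : (Σ a, Fin (l a)) ≃ Fin n) : (Σ i, Fin (∑ t, l (e ⟨i, t⟩))) ≃ Fin n :=
  (Equiv.sigmaCongrRight fun i =>
      (finSigmaFinEquiv (n := fun t => l (e ⟨i, t⟩))).symm).trans <|
    (Equiv.sigmaAssoc fun i t => Fin (l (e ⟨i, t⟩))).symm.trans <|
      (Equiv.sigmaCongrLeft (β := fun a => Fin (l a)) e).trans f

theorem assocShuffle_apply {m p n : ℕ} {k : Fin m → ℕ} (e : (Σ i, Fin (k i)) ≃ Fin p)
    {l : Fin p → ℕ} (f : (Σ a, Fin (l a)) ≃ Fin n) (i : Fin m) (t : Fin (k i))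
    (s : Fin (l (e ⟨i, t⟩))) :
    assocShuffle e f ⟨i, finSigmaFinEquiv (n := fun t => l (e ⟨i, t⟩)) ⟨t, s⟩⟩ =
      f ⟨e ⟨i, t⟩, s⟩ := by
  have h : (Equiv.sigmaCongrRight fun i =>
      (finSigmaFinEquiv (n := fun t => l (e ⟨i, t⟩))).symm)
        ⟨i, finSigmaFinEquiv (n := fun t => l (e ⟨i, t⟩)) ⟨t, s⟩⟩ = ⟨i, ⟨t, s⟩⟩ := by
    simp [Equiv.sigmaCongrRight]
  simp only [assocShuffle, Equiv.trans_apply, h]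
  rfl

/-- The value of `α` on the element with representative `(a, (l, f, z))`, with `a` itself a
representative of an element of `(X ∘ Y) p`. -/
def assocRep {X Y Z : SymColl.{w}} {p n : ℕ} (a : SubstRep X Y p) (l : Fin p → ℕ)
    (f : (Σ i, Fin (l i)) ≃ Fin n) (z : ∀ i, Z.level (l i)) : SubstRep X (subst Y Z) n where
  m := a.m
  k := fun i => ∑ t, l (a.shuffle ⟨i, t⟩)
  shuffle := assocShuffle a.shuffle f
  outer := a.outer
  inner := fun i => subst.mk
    { m := a.k i
      k := fun t => l (a.shuffle ⟨i, t⟩)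
      shuffle := finSigmaFinEquiv
      outer := a.inner i
      inner := fun t => z (a.shuffle ⟨i, t⟩) }

theorem act_finCongr (Z : SymColl.{w}) {p : ℕ} {l : Fin p → ℕ} (z : ∀ a, Z.level (l a))
    {a b : Fin p} (h : a = b) : Z.act (finCongr (congrArg l h)) (z a) = z b := by
  subst h
  exact act_refl Z (z a)

theorem assocRep_rel {X Y Z : SymColl.{w}} {p p' n : ℕ} {a : SubstRep X Y p}
    {a' : SubstRep X Y p'} {l : Fin p → ℕ} {l' : Fin p' → ℕ} {f : (Σ i, Fin (l i)) ≃ Fin n}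
    {f' : (Σ i, Fin (l' i)) ≃ Fin n} {z : ∀ i, Z.level (l i)} {z' : ∀ i, Z.level (l' i)}
    (π : Fin a.m ≃ Fin a'.m) (τ : ∀ i, Fin (a.k i) ≃ Fin (a'.k (π i)))
    (h1 : X.act π a.outer = a'.outer) (h2 : ∀ i, Y.act (τ i) (a.inner i) = a'.inner (π i))
    (σ : Fin p ≃ Fin p') (h3 : ∀ i t, σ (a.shuffle ⟨i, t⟩) = a'.shuffle ⟨π i, τ i t⟩)
    (ζ : ∀ i, Fin (l i) ≃ Fin (l' (σ i))) (h4 : ∀ i, Z.act (ζ i) (z i) = z' (σ i))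
    (h5 : ∀ i t, f' ⟨σ i, ζ i t⟩ = f ⟨i, t⟩) :
    (assocRep a l f z).Rel (assocRep a' l' f' z') := by
  let ξ : ∀ i (t : Fin (a.k i)), Fin (l (a.shuffle ⟨i, t⟩)) ≃
      Fin (l' (a'.shuffle ⟨π i, τ i t⟩)) := fun i t =>
    (ζ (a.shuffle ⟨i, t⟩)).trans (finCongr (congrArg l' (h3 i t)))
  let θ : ∀ i, Fin (∑ t, l (a.shuffle ⟨i, t⟩)) ≃ Fin (∑ t, l' (a'.shuffle ⟨π i, t⟩)) := fun i =>
    (finSigmaFinEquiv (n := fun t => l (a.shuffle ⟨i, t⟩))).symm.trans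
      ((Equiv.sigmaCongr (τ i) (ξ i)).trans
        (finSigmaFinEquiv (n := fun t => l' (a'.shuffle ⟨π i, t⟩))))
  have hθ : ∀ i t s, θ i (finSigmaFinEquiv (n := fun t => l (a.shuffle ⟨i, t⟩)) ⟨t, s⟩) =
      finSigmaFinEquiv (n := fun t => l' (a'.shuffle ⟨π i, t⟩)) ⟨τ i t, ξ i t s⟩ := by
    intro i t s
    simp only [θ, Equiv.trans_apply, Equiv.symm_apply_apply]
    rfl
  refine ⟨π, θ, h1, fun i => subst.sound ⟨τ i, ξ i, h2 i, fun t => ?_, fun t s => ?_⟩, ?_⟩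
  · refine (act_trans Z _ _ _).trans ?_
    refine (congrArg _ (h4 _)).trans ?_
    exact act_finCongr Z z' (h3 i t)
  · exact (hθ i t s).symm
  · intro i u
    obtain ⟨⟨t, s⟩, rfl⟩ := (finSigmaFinEquiv (n := fun t => l (a.shuffle ⟨i, t⟩))).surjective u
    refine (congrArg (fun v => assocShuffle a'.shuffle f' ⟨π i, v⟩) (hθ i t s)).trans ?_
    refine (assocShuffle_apply a'.shuffle f' (π i) (τ i t) (ξ i t s)).trans ?_
    refine Eq.trans ?_ (assocShuffle_apply a.shuffle f i t s).symm
    refine Eq.trans ?_ (h5 _ s)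
    congr 1
    have key : ∀ {c d : Fin p'} (h : c = d) (r : Fin (l' c)),
        (⟨d, finCongr (congrArg l' h) r⟩ : Σ i, Fin (l' i)) = ⟨c, r⟩ := by
      rintro c _ rfl r
      rfl
    exact key (h3 i t) _

/-- `α : (X ∘ Y) ∘ Z ⟶ X ∘ (Y ∘ Z)`. -/
def substAssoc (X Y Z : SymColl.{w}) : subst (subst X Y) Z ⟶ subst X (subst Y Z) where
  app n := ↾(Quot.lift
    (fun a => Quot.lift
      (fun b : SubstRep X Y a.m => subst.mk (assocRep b a.k a.shuffle a.inner))
      (by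
        rintro b b' ⟨π, τ, h1, h2, h3⟩
        exact subst.sound (assocRep_rel π τ h1 h2 (Equiv.refl _) (fun i t => (h3 i t).symm)
          (fun _ => Equiv.refl _) (fun i => act_refl Z _) (fun _ _ => rfl)))
      a.outer)
    (by
      rintro ⟨m, k, e, ⟨b⟩, z⟩ ⟨m', k', e', x', z'⟩ ⟨π, τ, h1, h2, h3⟩
      dsimp only at π τ h1 h2 h3
      subst h1
      exact subst.sound (assocRep_rel (a' := { b with shuffle := b.shuffle.trans π })
        (Equiv.refl _) (fun _ => Equiv.refl _) (act_refl X _) (fun i => act_refl Y _) π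
        (fun _ _ => rfl) τ h2 h3)))
  naturality n n' σ := by
    ext ⟨⟨m, k, e, ⟨b⟩, z⟩⟩
    rfl

/-- The substitution (skew) monoidal structure on `[ℙ, Set]`. -/
noncomputable def substitution : SkewMonoidalStruct SymColl.{w} where
  tensorObj := subst
  tensorHom f g := substMap f g
  tensor_id X Y := by
    ext n ⟨a⟩
    rfl
  tensor_comp f f' g g' := by
    ext n ⟨a⟩
    rfl
  unit := substUnit
  assoc := substAssoc
  left := substLeft
  right := substRight

/-- The functor sending a symmetric collection to its underlying family of sets. -/
def toFamily : SymColl.{w} ⥤ (FinCard → Type w) where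
  obj X := fun n => X.level n.card
  map f := fun n => f.app ⟨n.card⟩

end SymColl

/-! ## Symmetric operads -/

open SymColl in
/-- A (classical) symmetric operad in sets: sets `P n` with actions of the symmetric groups, an
identity in `P 1`, and composition maps
`γ : P m × P (k₁) × ⋯ × P (k_m) → P (k₁ + ⋯ + k_m)`
which are associative, unital and equivariant. The bijections which appear in `comp_assoc`,
`one_comp` and `comp_one` are the increasing ones; those in `comp_act` and `act_comp` are
respectively the direct sum of the `τ i`, and the permutation of blocks induced by `π`. -/
structure SymOperad : Type (w + 1) where
  P : SymColl.{w}
  one : P.level 1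
  comp : ∀ {m : ℕ} (k : Fin m → ℕ), P.level m → (∀ i, P.level (k i)) → P.level (∑ i, k i)
  comp_act : ∀ {m : ℕ} (k k' : Fin m → ℕ) (τ : ∀ i, Fin (k i) ≃ Fin (k' i))
    (x : P.level m) (y : ∀ i, P.level (k i)),
    comp k' x (fun i => P.act (τ i) (y i)) =
      P.act (finSigmaFinEquiv.symm.trans ((Equiv.sigmaCongrRight τ).trans finSigmaFinEquiv))
        (comp k x y)
  act_comp : ∀ {m m' : ℕ} (k : Fin m' → ℕ) (π : Fin m ≃ Fin m')
    (x : P.level m) (y : ∀ i, P.level (k i)),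
    comp k (P.act π x) y =
      P.act (finSigmaFinEquiv.symm.trans
          ((Equiv.sigmaCongrLeft (β := fun i => Fin (k i)) π).trans finSigmaFinEquiv))
        (comp (fun i => k (π i)) x (fun i => y (π i)))
  one_comp : ∀ {n : ℕ} (x : P.level n),
    P.act (finSigmaFinEquiv.symm.trans (Equiv.uniqueSigma fun _ : Fin 1 => Fin n))
      (comp (fun _ : Fin 1 => n) one (fun _ => x)) = x
  comp_one : ∀ {n : ℕ} (x : P.level n),
    P.act (finSigmaFinEquiv.symm.trans (Equiv.sigmaUnique (Fin n) fun _ => Fin 1))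
      (comp (fun _ : Fin n => 1) x (fun _ => one)) = x
  comp_assoc : ∀ {m : ℕ} (k : Fin m → ℕ) (l : Fin (∑ i, k i) → ℕ)
    (x : P.level m) (y : ∀ i, P.level (k i)) (z : ∀ a, P.level (l a)),
    P.act ((assocShuffle finSigmaFinEquiv finSigmaFinEquiv).symm.trans finSigmaFinEquiv)
      (comp l (comp k x y) z) =
    comp (fun i => ∑ t, l (finSigmaFinEquiv ⟨i, t⟩)) x
      (fun i => comp (fun t => l (finSigmaFinEquiv ⟨i, t⟩)) (y i)
        (fun t => z (finSigmaFinEquiv ⟨i, t⟩)))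

namespace SymOperad

/-- Morphisms of symmetric operads. -/
@[ext]
structure Hom (A B : SymOperad.{w}) where
  hom : A.P ⟶ B.P
  hom_one : hom.app ⟨1⟩ A.one = B.one
  hom_comp : ∀ {m : ℕ} (k : Fin m → ℕ) (x : A.P.level m) (y : ∀ i, A.P.level (k i)),
    hom.app ⟨∑ i, k i⟩ (A.comp k x y) = B.comp k (hom.app ⟨m⟩ x) (fun i => hom.app ⟨k i⟩ (y i))

instance : Category SymOperad.{w} where
  Hom := Hom
  id A := ⟨𝟙 A.P, rfl, fun _ _ _ => rfl⟩
  comp f g := ⟨f.hom ≫ g.hom,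
    (congrArg (fun x => g.hom.app ⟨1⟩ x) f.hom_one).trans g.hom_one,
    fun k x y => (congrArg (fun x => g.hom.app _ x) (f.hom_comp k x y)).trans (g.hom_comp k _ _)⟩

/-- The functor sending a symmetric operad to its underlying symmetric collection. -/
def forget : SymOperad.{w} ⥤ SymColl.{w} where
  obj A := A.P
  map f := f.hom

end SymOperad

/-!
The underlying family of a symmetric collection defines a functor `V : [ℙ, Set] ⥤ Coll`, and there
is a comparison `q : V X * V Y ⟶ V (X ∘ Y)` (`SymColl.quot`): an element `(φ, x, y)` of `X * Y` is a
representative of an element of `X ∘ Y` whose blocks are the fibres of `φ`, each enumerated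
increasingly. Two facts about `q` carry the proof.

* `q` makes `V` a lax monoidal functor (`SymColl.laxStructure`) and it is surjective, since every
  representative can be relabelled so that its blocks are increasingly enumerated. Hence the
  coherence axioms for substitution follow from those for `Coll`
  (`SkewMonoidalStruct.LaxStructure.isSkewMonoidal`), and the latter amount to equalities between
  increasing inclusions with the same range.
* `q` is the coequalizer of the two maps `(X * U) * Y ⟶ X * Y` (`SymColl.quotIsCoequalizer`). The
  relation which defines `X ∘ Y` is an equivalence relation (`SymColl.subst.exact`), and two
  representatives given by functions `φ` and `φ'` are related only if `φ' = π φ` for a bijection `π`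
  which carries one to the other; the bijections between the blocks are forced to be the increasing
  ones. This is exactly the identification imposed by the action of `U`.

Since the fibrewise trivial morphisms are the bijections, a `U`-module is a family of sets on which
bijections act contravariantly, so that inverting bijections gives an equivalence `SymColl.ofModule`
from `U`-modules to symmetric collections. By the second fact, any right normalization has its
tensor product isomorphic to the substitution product, compatibly with the maps from `M * N`
(`SymColl.comparison`). As these maps are epimorphisms, the constraints correspond
(`SkewMonoidalStruct.LaxStructure.factor`), so `SymColl.ofModule` is strong monoidal, and the right
normalization is monoidal because substitution is. The associativity of substitution is shown to be
invertible on representatives.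

Finally a monoid for substitution is the same as a symmetric operad: its multiplication is
determined by its values on representatives with consecutive blocks, and compatibility with the
relation on representatives is equivariance (`SymColl.monToOperad`). An equivalence which
is strong monoidal induces one between the categories of monoids.
-/

/-! ### Lax monoidal functors between skew monoidal categories -/

namespace SkewMonoidalStruct

universe v₁ v₂ v₃ u₁ u₂ u₃

variable {E : Type u₁} [Category.{v₁} E] {E' : Type u₂} [Category.{v₂} E']
  {E'' : Type u₃} [Category.{v₃} E'']

namespace IsSkewMonoidal

variable {D : SkewMonoidalStruct E} (h : D.IsSkewMonoidal)

include h

theorem assoc_natural_left {X X' : E} (f : X ⟶ X') (Y Z : E) :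
    D.tensorHom (D.tensorHom f (𝟙 Y)) (𝟙 Z) ≫ D.assoc X' Y Z =
      D.assoc X Y Z ≫ D.tensorHom f (𝟙 (D.tensorObj Y Z)) := by
  rw [h.assoc_natural, D.tensor_id]

theorem assoc_natural_right (X Y : E) {Z Z' : E} (k : Z ⟶ Z') :
    D.tensorHom (𝟙 (D.tensorObj X Y)) k ≫ D.assoc X Y Z' =
      D.assoc X Y Z ≫ D.tensorHom (𝟙 X) (D.tensorHom (𝟙 Y) k) := by
  rw [← h.assoc_natural, D.tensor_id]

end IsSkewMonoidal

theorem tensorHom_exchange (D : SkewMonoidalStruct E) {X X' Y Y' : E} (f : X ⟶ X') (g : Y ⟶ Y') :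
    D.tensorHom f (𝟙 Y) ≫ D.tensorHom (𝟙 X') g = D.tensorHom (𝟙 X) g ≫ D.tensorHom f (𝟙 Y') := by
  simp only [← D.tensor_comp, Category.comp_id, Category.id_comp]

/-- A lax monoidal structure on a functor `V` between skew monoidal categories: a natural comparison
`q : V X * V Y ⟶ V (X * Y)` and a map `e : U ⟶ V U`, compatible with the constraints. -/
structure LaxStructure (D' : SkewMonoidalStruct E') (D : SkewMonoidalStruct E) (V : E' ⥤ E) where
  q : ∀ X Y : E', D.tensorObj (V.obj X) (V.obj Y) ⟶ V.obj (D'.tensorObj X Y)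
  e : D.unit ⟶ V.obj D'.unit
  q_natural : ∀ {X X' Y Y' : E'} (f : X ⟶ X') (g : Y ⟶ Y'),
    q X Y ≫ V.map (D'.tensorHom f g) = D.tensorHom (V.map f) (V.map g) ≫ q X' Y'
  q_assoc : ∀ X Y Z : E',
    D.tensorHom (q X Y) (𝟙 (V.obj Z)) ≫ q (D'.tensorObj X Y) Z ≫ V.map (D'.assoc X Y Z) =
      D.assoc (V.obj X) (V.obj Y) (V.obj Z) ≫ D.tensorHom (𝟙 (V.obj X)) (q Y Z) ≫
        q X (D'.tensorObj Y Z)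
  q_left : ∀ X : E',
    D.tensorHom e (𝟙 (V.obj X)) ≫ q D'.unit X ≫ V.map (D'.left X) = D.left (V.obj X)
  q_right : ∀ X : E',
    V.map (D'.right X) = D.right (V.obj X) ≫ D.tensorHom (𝟙 (V.obj X)) e ≫ q X D'.unit

namespace LaxStructure

variable {D'' : SkewMonoidalStruct E''} {D' : SkewMonoidalStruct E'} {D : SkewMonoidalStruct E}
  {V : E' ⥤ E} (L : LaxStructure D' D V)

/-- The comparison maps of a lax monoidal structure, and those of their tensor products which
occur in the coherence axioms, are epimorphisms. -/
structure IsEpi (L : LaxStructure D' D V) : Prop where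
  e : Epi L.e
  e_left : ∀ X, Epi (D.tensorHom L.e (𝟙 (V.obj X)))
  e_left_left : ∀ X Y, Epi (D.tensorHom (D.tensorHom L.e (𝟙 (V.obj X))) (𝟙 (V.obj Y)))
  q : ∀ X Y, Epi (L.q X Y)
  q_left : ∀ X Y Z, Epi (D.tensorHom (L.q X Y) (𝟙 (V.obj Z)))
  q_left_left : ∀ X Y Z W,
    Epi (D.tensorHom (D.tensorHom (L.q X Y) (𝟙 (V.obj Z))) (𝟙 (V.obj W)))

theorem q_natural_left {X X' : E'} (f : X ⟶ X') (Y : E') :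
    L.q X Y ≫ V.map (D'.tensorHom f (𝟙 Y)) =
      D.tensorHom (V.map f) (𝟙 (V.obj Y)) ≫ L.q X' Y := by
  rw [L.q_natural, V.map_id]

theorem q_natural_right (X : E') {Y Y' : E'} (f : Y ⟶ Y') :
    L.q X Y ≫ V.map (D'.tensorHom (𝟙 X) f) =
      D.tensorHom (𝟙 (V.obj X)) (V.map f) ≫ L.q X Y' := by
  rw [L.q_natural, V.map_id]

/-- A faithful lax monoidal functor whose comparison maps are epimorphisms reflects the coherence
axioms: each axiom in the domain becomes, after precomposition with comparison maps, the same axiom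
in the codomain. -/
theorem isSkewMonoidal [V.Faithful] (hL : L.IsEpi) (h : D.IsSkewMonoidal) :
    D'.IsSkewMonoidal := by
  have := hL.e
  have := hL.e_left
  have := hL.e_left_left
  have := hL.q
  have := hL.q_left
  have := hL.q_left_left
  constructor
  case assoc_natural =>
    intro X X' Y Y' Z Z' f g k
    apply V.map_injective
    rw [← cancel_epi (L.q _ _), ← cancel_epi (D.tensorHom (L.q X Y) (𝟙 (V.obj Z)))]
    have h1 : D.tensorHom (L.q X Y) (𝟙 (V.obj Z)) ≫
        D.tensorHom (V.map (D'.tensorHom f g)) (V.map k) =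
        D.tensorHom (D.tensorHom (V.map f) (V.map g)) (V.map k) ≫
          D.tensorHom (L.q X' Y') (𝟙 (V.obj Z')) := by
      simp only [← D.tensor_comp, L.q_natural, Category.comp_id, Category.id_comp]
    have h2 : D.tensorHom (𝟙 (V.obj X)) (L.q Y Z) ≫
        D.tensorHom (V.map f) (V.map (D'.tensorHom g k)) =
        D.tensorHom (V.map f) (D.tensorHom (V.map g) (V.map k)) ≫
          D.tensorHom (𝟙 (V.obj X')) (L.q Y' Z') := by
      simp only [← D.tensor_comp, L.q_natural, Category.comp_id, Category.id_comp]
    rw [V.map_comp, V.map_comp, reassoc_of% L.q_natural, reassoc_of% h1, L.q_assoc,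
      reassoc_of% h.assoc_natural, reassoc_of% L.q_assoc, L.q_natural, reassoc_of% h2]
  case left_natural =>
    intro X X' f
    apply V.map_injective
    rw [← cancel_epi (L.q _ _), ← cancel_epi (D.tensorHom L.e (𝟙 (V.obj X))), V.map_comp,
      V.map_comp, reassoc_of% L.q_natural_right, reassoc_of% L.q_left,
      reassoc_of% D.tensorHom_exchange, L.q_left, h.left_natural]
  case right_natural =>
    intro X X' f
    apply V.map_injective
    rw [V.map_comp, V.map_comp, L.q_right, L.q_right, Category.assoc, Category.assoc,
      L.q_natural_left, ← reassoc_of% D.tensorHom_exchange, reassoc_of% h.right_natural]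
  case right_left =>
    apply V.map_injective
    rw [← cancel_epi L.e, V.map_comp, L.q_right, Category.assoc, Category.assoc, V.map_id,
      ← reassoc_of% h.right_natural, reassoc_of% D.tensorHom_exchange, L.q_left, h.left_natural,
      reassoc_of% h.right_left, Category.comp_id]
  case assoc_left =>
    intro X Y
    apply V.map_injective
    have h1 : D.tensorHom (D.tensorHom L.e (𝟙 (V.obj X))) (𝟙 (V.obj Y)) ≫
        D.tensorHom (L.q D'.unit X) (𝟙 (V.obj Y)) ≫
          D.tensorHom (V.map (D'.left X)) (𝟙 (V.obj Y)) =
        D.tensorHom (D.left (V.obj X)) (𝟙 (V.obj Y)) := by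
      simp only [← D.tensor_comp, L.q_left, Category.comp_id]
    rw [← cancel_epi (L.q _ _), ← cancel_epi (D.tensorHom (L.q D'.unit X) (𝟙 (V.obj Y))),
      ← cancel_epi (D.tensorHom (D.tensorHom L.e (𝟙 (V.obj X))) (𝟙 (V.obj Y))), V.map_comp,
      reassoc_of% L.q_assoc, reassoc_of% h.assoc_natural_left, reassoc_of% D.tensorHom_exchange,
      L.q_left, h.left_natural, reassoc_of% h.assoc_left, L.q_natural_left, reassoc_of% h1]
  case right_assoc =>
    intro X Y
    apply V.map_injective
    have h1 : D.tensorHom (𝟙 (V.obj X)) (D.right (V.obj Y)) ≫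
        D.tensorHom (𝟙 (V.obj X)) (D.tensorHom (𝟙 (V.obj Y)) L.e) ≫
          D.tensorHom (𝟙 (V.obj X)) (L.q Y D'.unit) =
        D.tensorHom (𝟙 (V.obj X)) (V.map (D'.right Y)) := by
      simp only [← D.tensor_comp, L.q_right, Category.comp_id]
    rw [← cancel_epi (L.q _ _), V.map_comp, L.q_right, Category.assoc, Category.assoc,
      ← reassoc_of% h.right_natural, reassoc_of% D.tensorHom_exchange, L.q_assoc,
      reassoc_of% h.assoc_natural_right, reassoc_of% h.right_assoc, L.q_natural_right,
      reassoc_of% h1]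
  case right_assoc_left =>
    intro X Y
    apply V.map_injective
    have h1 : D.tensorHom (V.map (D'.right X)) (𝟙 (V.obj Y)) =
        D.tensorHom (D.right (V.obj X)) (𝟙 (V.obj Y)) ≫
          D.tensorHom (D.tensorHom (𝟙 (V.obj X)) L.e) (𝟙 (V.obj Y)) ≫
            D.tensorHom (L.q X D'.unit) (𝟙 (V.obj Y)) := by
      simp only [← D.tensor_comp, L.q_right, Category.comp_id]
    have h2 : D.tensorHom (𝟙 (V.obj X)) (D.tensorHom L.e (𝟙 (V.obj Y))) ≫
        D.tensorHom (𝟙 (V.obj X)) (L.q D'.unit Y) ≫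
          D.tensorHom (𝟙 (V.obj X)) (V.map (D'.left Y)) =
        D.tensorHom (𝟙 (V.obj X)) (D.left (V.obj Y)) := by
      simp only [← D.tensor_comp, L.q_left, Category.comp_id]
    have h3 := h.right_assoc_left (V.obj X) (V.obj Y)
    rw [← cancel_epi (L.q _ _), V.map_comp, V.map_comp, reassoc_of% L.q_natural_left, h1,
      Category.assoc, Category.assoc, reassoc_of% L.q_assoc, L.q_natural_right,
      reassoc_of% h.assoc_natural, reassoc_of% h2, reassoc_of% h3, V.map_id, Category.comp_id]
  case pentagon =>
    intro W X Y Z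
    apply V.map_injective
    have h1 : D.tensorHom (D.tensorHom (L.q W X) (𝟙 (V.obj Y))) (𝟙 (V.obj Z)) ≫
        D.tensorHom (L.q (D'.tensorObj W X) Y) (𝟙 (V.obj Z)) ≫
          D.tensorHom (V.map (D'.assoc W X Y)) (𝟙 (V.obj Z)) =
        D.tensorHom (D.assoc (V.obj W) (V.obj X) (V.obj Y)) (𝟙 (V.obj Z)) ≫
          D.tensorHom (D.tensorHom (𝟙 (V.obj W)) (L.q X Y)) (𝟙 (V.obj Z)) ≫
            D.tensorHom (L.q W (D'.tensorObj X Y)) (𝟙 (V.obj Z)) := by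
      simp only [← D.tensor_comp, L.q_assoc, Category.comp_id]
    have h2 : D.tensorHom (𝟙 (V.obj W)) (D.tensorHom (L.q X Y) (𝟙 (V.obj Z))) ≫
        D.tensorHom (𝟙 (V.obj W)) (L.q (D'.tensorObj X Y) Z) ≫
          D.tensorHom (𝟙 (V.obj W)) (V.map (D'.assoc X Y Z)) =
        D.tensorHom (𝟙 (V.obj W)) (D.assoc (V.obj X) (V.obj Y) (V.obj Z)) ≫
          D.tensorHom (𝟙 (V.obj W)) (D.tensorHom (𝟙 (V.obj X)) (L.q Y Z)) ≫
            D.tensorHom (𝟙 (V.obj W)) (L.q X (D'.tensorObj Y Z)) := by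
      simp only [← D.tensor_comp, L.q_assoc, Category.comp_id]
    have h3 := h.pentagon (V.obj W) (V.obj X) (V.obj Y) (V.obj Z)
    rw [← cancel_epi (L.q _ _), ← cancel_epi (D.tensorHom (L.q _ _) (𝟙 (V.obj Z))),
      ← cancel_epi (D.tensorHom (D.tensorHom (L.q W X) (𝟙 (V.obj Y))) (𝟙 (V.obj Z))),
      V.map_comp, V.map_comp, V.map_comp, reassoc_of% L.q_natural_left, reassoc_of% h1,
      reassoc_of% L.q_assoc, L.q_natural_right, reassoc_of% h.assoc_natural, reassoc_of% h2,
      reassoc_of% h3, reassoc_of% L.q_assoc, reassoc_of% h.assoc_natural_left,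
      reassoc_of% D.tensorHom_exchange, L.q_assoc, reassoc_of% h.assoc_natural_right]

/-- A lax monoidal structure on a composite `F ⋙ V` whose comparison maps factor through those of
an epimorphic lax monoidal structure on the faithful functor `V` gives one on `F`. -/
def factor [V.Faithful] (hL : L.IsEpi) {F : E'' ⥤ E'} (L' : LaxStructure D'' D (F ⋙ V))
    (μ : ∀ X Y, D'.tensorObj (F.obj X) (F.obj Y) ⟶ F.obj (D''.tensorObj X Y))
    (η : D'.unit ⟶ F.obj D''.unit) (hμ : ∀ X Y, L.q (F.obj X) (F.obj Y) ≫ V.map (μ X Y) = L'.q X Y)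
    (hη : L.e ≫ V.map η = L'.e) : LaxStructure D'' D' F where
  q := μ
  e := η
  q_natural {X X' Y Y'} f g := by
    have := hL.q
    apply V.map_injective
    rw [← cancel_epi (L.q _ _), V.map_comp, V.map_comp, reassoc_of% hμ, reassoc_of% L.q_natural, hμ]
    exact L'.q_natural f g
  q_assoc X Y Z := by
    have := hL.q
    have := hL.q_left
    apply V.map_injective
    have h1 : D.tensorHom (L.q (F.obj X) (F.obj Y)) (𝟙 (V.obj (F.obj Z))) ≫
        D.tensorHom (V.map (μ X Y)) (𝟙 (V.obj (F.obj Z))) =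
          D.tensorHom (L'.q X Y) (𝟙 (V.obj (F.obj Z))) := by
      simp only [← D.tensor_comp, hμ, Category.comp_id]
    have h2 : D.tensorHom (𝟙 (V.obj (F.obj X))) (L.q (F.obj Y) (F.obj Z)) ≫
        D.tensorHom (𝟙 (V.obj (F.obj X))) (V.map (μ Y Z)) =
          D.tensorHom (𝟙 (V.obj (F.obj X))) (L'.q Y Z) := by
      simp only [← D.tensor_comp, hμ, Category.comp_id]
    rw [← cancel_epi (L.q _ _), ← cancel_epi (D.tensorHom (L.q _ _) (𝟙 (V.obj (F.obj Z)))),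
      V.map_comp, V.map_comp, V.map_comp, V.map_comp, reassoc_of% L.q_natural_left, reassoc_of% hμ,
      reassoc_of% h1, reassoc_of% L.q_assoc, reassoc_of% L.q_natural_right, reassoc_of% h2, hμ]
    exact L'.q_assoc X Y Z
  q_left X := by
    have := hL.q
    have := hL.e_left
    apply V.map_injective
    have h1 : D.tensorHom L.e (𝟙 (V.obj (F.obj X))) ≫
        D.tensorHom (V.map η) (𝟙 (V.obj (F.obj X))) =
          D.tensorHom L'.e (𝟙 (V.obj (F.obj X))) := by
      simp only [← D.tensor_comp, hη, Category.comp_id]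
    rw [← cancel_epi (L.q _ _), ← cancel_epi (D.tensorHom L.e (𝟙 (V.obj (F.obj X)))),
      V.map_comp, V.map_comp, reassoc_of% L.q_natural_left, reassoc_of% hμ, reassoc_of% h1,
      L.q_left]
    exact L'.q_left X
  q_right X := by
    apply V.map_injective
    have h2 : D.tensorHom (𝟙 (V.obj (F.obj X))) L.e ≫
        D.tensorHom (𝟙 (V.obj (F.obj X))) (V.map η) =
          D.tensorHom (𝟙 (V.obj (F.obj X))) L'.e := by
      simp only [← D.tensor_comp, hη, Category.comp_id]
    rw [V.map_comp, V.map_comp, L.q_right, Category.assoc, Category.assoc,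
      reassoc_of% L.q_natural_right, hμ, reassoc_of% h2]
    exact L'.q_right X

/-- A skew monoidal category is monoidal when it has a strong monoidal functor, faithful and
reflecting isomorphisms, to a monoidal category. -/
theorem isMonoidal [V.Faithful] [V.ReflectsIsomorphisms] (hq : ∀ X Y, IsIso (L.q X Y))
    (he : IsIso L.e) (h : D.IsMonoidal) : D'.IsMonoidal := by
  have iso : ∀ {X X' Y Y' : E} (f : X ⟶ X') (g : Y ⟶ Y'), IsIso f → IsIso g →
      IsIso (D.tensorHom f g) := fun f g _ _ => ⟨D.tensorHom (inv f) (inv g), by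
    simp only [← D.tensor_comp, IsIso.hom_inv_id, IsIso.inv_hom_id, D.tensor_id, and_self]⟩
  have := fun X Y Z => iso (L.q X Y) (𝟙 (V.obj Z)) inferInstance inferInstance
  have := fun X => iso L.e (𝟙 (V.obj X)) inferInstance inferInstance
  have := fun X Y Z => iso (𝟙 (V.obj Z)) (L.q X Y) inferInstance inferInstance
  have := fun X => iso (𝟙 (V.obj X)) L.e inferInstance inferInstance
  have := h.isIso_assoc
  have := h.isIso_left
  have := h.isIso_right
  refine { L.isSkewMonoidal ⟨inferInstance, inferInstance, fun X Y => ?_, inferInstance,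
    inferInstance, fun X Y Z W => ?_⟩ h.toIsSkewMonoidal with
    isIso_assoc := fun X Y Z => ?_
    isIso_left := fun X => ?_
    isIso_right := fun X => ?_ }
  · have := iso _ (𝟙 (V.obj Y)) (iso L.e (𝟙 (V.obj X)) inferInstance inferInstance) inferInstance
    infer_instance
  · have := iso _ (𝟙 (V.obj W)) (iso (L.q X Y) (𝟙 (V.obj Z)) inferInstance inferInstance)
      inferInstance
    infer_instance
  · have := L.q_assoc X Y Z
    have : IsIso (V.map (D'.assoc X Y Z)) := by
      rw [← IsIso.eq_inv_comp, ← IsIso.eq_inv_comp] at this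
      rw [this]
      infer_instance
    exact isIso_of_reflects_iso _ V
  · have := L.q_left X
    have : IsIso (V.map (D'.left X)) := by
      rw [← IsIso.eq_inv_comp, ← IsIso.eq_inv_comp] at this
      rw [this]
      infer_instance
    exact isIso_of_reflects_iso _ V
  · have := L.q_right X
    have : IsIso (V.map (D'.right X)) := by
      rw [this]
      infer_instance
    exact isIso_of_reflects_iso _ V

/-- A lax monoidal structure with invertible comparison maps, as a strong monoidal structure. -/
@[reducible]
noncomputable def monoidal (hq : ∀ X Y, IsIso (L.q X Y))
    (he : IsIso L.e) (h' : D'.IsMonoidal) (h : D.IsMonoidal) :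
    letI := h'.monoidalCategory
    letI := h.monoidalCategory
    V.Monoidal :=
  letI := h'.monoidalCategory
  letI := h.monoidalCategory
  Functor.CoreMonoidal.toMonoidal (F := V)
    { εIso := asIso L.e
      μIso := fun X Y => asIso (L.q X Y)
      μIso_hom_natural_left := fun f X => (L.q_natural_left f X).symm
      μIso_hom_natural_right := fun X f => (L.q_natural_right X f).symm
      associativity := fun X Y Z => L.q_assoc X Y Z
      left_unitality := fun X => (L.q_left X).symm
      right_unitality := fun X => by
        have := h.isIso_right (V.obj X)
        have := h'.isIso_right X
        change inv (D.right (V.obj X)) = D.tensorHom (𝟙 (V.obj X)) L.e ≫ L.q X D'.unit ≫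
          V.map (inv (D'.right X))
        rw [V.map_inv, ← Category.assoc, IsIso.eq_comp_inv, IsIso.inv_comp_eq, L.q_right] }

end LaxStructure

end SkewMonoidalStruct

/-! ### Fibres of functions of finite cardinals -/

namespace FinCard

/-- The number of elements of a fibre. -/
abbrev fibreCard {a b : FinCard} (φ : a ⟶ b) (i : Fin b.card) : ℕ :=
  (fibre φ i).card

/-- The inclusion of the fibre over `i`, for a function of finite cardinals. -/
def fibIncl {a b : FinCard} (φ : a ⟶ b) (i : Fin b.card) : Fin (fibreCard φ i) → Fin a.card :=
  incl (Over.mk φ) i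

section

variable {a b c : FinCard}

theorem fibIncl_strictMono (φ : a ⟶ b) (i : Fin b.card) : StrictMono (fibIncl φ i) :=
  incl_strictMono (Over.mk φ) i

theorem apply_fibIncl (φ : a ⟶ b) (i : Fin b.card) (t : Fin (fibreCard φ i)) :
    fn φ (fibIncl φ i t) = i :=
  (range_incl (Over.mk φ) i).subset ⟨t, rfl⟩

theorem exists_fibIncl (φ : a ⟶ b) {i : Fin b.card} {x : Fin a.card} (h : fn φ x = i) :
    ∃ t, fibIncl φ i t = x :=
  (range_incl (Over.mk φ) i).superset h

theorem fibIncl_fibreMap (φ : a ⟶ b) (ψ : b ⟶ c) (i : Fin c.card)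
    (t : Fin (fibreCard (φ ≫ ψ) i)) :
    fibIncl ψ i (fn (fibreMap φ ψ i) t) = fn φ (fibIncl (φ ≫ ψ) i t) :=
  incl_map (Over.homMk φ : Over.mk (φ ≫ ψ) ⟶ Over.mk ψ) i t

/-- Fibres in a pullback square whose vertical maps are increasing inclusions. -/
theorem fibIncl_of_square {a' b' : FinCard} {g : a ⟶ b} {g' : a' ⟶ b'}
    {u : Fin a.card → Fin a'.card} (hu : StrictMono u) {v : Fin b.card → Fin b'.card}
    (hv : Function.Injective v) (comm : ∀ t, v (fn g t) = fn g' (u t)) {i : Fin b.card}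
    {i' : Fin b'.card} (hi : v i = i') (pull : ∀ x, fn g' x = i' → ∃ t, u t = x) :
    ∃ e : fibreCard g i = fibreCard g' i',
      ∀ t, u (fibIncl g i t) = fibIncl g' i' (Fin.cast e t) := by
  subst hi
  refine strictMono_unique (hu.comp (fibIncl_strictMono g i)) (fibIncl_strictMono g' (v i)) ?_
  ext x
  constructor
  · rintro ⟨t, rfl⟩
    exact exists_fibIncl g' ((comm _).symm.trans (congrArg v (apply_fibIncl g i t)))
  · rintro ⟨s, rfl⟩
    obtain ⟨t, ht⟩ := pull _ (apply_fibIncl g' (v i) s)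
    have h : fn g t = i := hv ((comm t).trans ((congrArg (fn g') ht).trans (apply_fibIncl g' _ s)))
    obtain ⟨r, rfl⟩ := exists_fibIncl g h
    exact ⟨r, ht⟩

/-- The fibres of a map `g` induced by `φ` on the fibres of `ψ` are fibres of `φ`. -/
theorem fibIncl_fibIncl (φ : a ⟶ b) (ψ : b ⟶ c) (j : Fin c.card)
    (g : fibre (φ ≫ ψ) j ⟶ fibre ψ j)
    (hg : ∀ t, fibIncl ψ j (fn g t) = fn φ (fibIncl (φ ≫ ψ) j t))
    (i : Fin (fibreCard ψ j)) :
    ∃ e : fibreCard g i = fibreCard φ (fibIncl ψ j i),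
      ∀ t, fibIncl (φ ≫ ψ) j (fibIncl g i t) = fibIncl φ (fibIncl ψ j i) (Fin.cast e t) :=
  fibIncl_of_square (fibIncl_strictMono (φ ≫ ψ) j) (fibIncl_strictMono ψ j).injective hg rfl
    fun _ hx => exists_fibIncl (φ ≫ ψ)
      ((congrArg (fn ψ) hx).trans (apply_fibIncl ψ j i))

/-- The fibre of a map to a one-element set is the whole domain. -/
theorem fibIncl_of_card_eq_one (φ : a ⟶ b) (hb : b.card = 1) (i : Fin b.card) :
    ∃ e : fibreCard φ i = a.card, ∀ t, fibIncl φ i t = Fin.cast e t :=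
  strictMono_unique (g := fun x => x) (fibIncl_strictMono φ i) strictMono_id <| by
    refine Set.ext fun x => ⟨fun _ => ⟨_, rfl⟩, fun _ => exists_fibIncl φ (Fin.ext ?_)⟩
    have := (fn φ x).2
    have := i.2
    omega

theorem fibrewiseTrivial_iff_bijective (φ : a ⟶ b) :
    FibrewiseTrivial φ ↔ Function.Bijective (fn φ) := by
  constructor
  · intro h
    refine ⟨fun x y hxy => ?_, fun i => ?_⟩
    · obtain ⟨s, hs⟩ := exists_fibIncl φ (x := x) rfl
      obtain ⟨t, ht⟩ := exists_fibIncl φ (x := y) hxy.symm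
      have h1 : fibreCard φ (fn φ x) = 1 := (h _).1
      have hst : s = t := Fin.ext (by have := s.2; have := t.2; omega)
      exact hs.symm.trans ((congrArg _ hst).trans ht)
    · have h1 : fibreCard φ i = 1 := (h i).1
      exact ⟨fibIncl φ i (Fin.cast h1.symm 0), apply_fibIncl φ i _⟩
  · intro h i
    refine isTrivialObj_of_card ?_
    obtain ⟨x, hx⟩ := h.2 i
    change (fibreSet (fn φ) i).card = 1
    refine Finset.card_eq_one.2 ⟨x, Finset.ext fun y => ?_⟩
    rw [Finset.mem_singleton]
    exact mem_fibreSet.trans ⟨fun hy => h.1 (hy.trans hx.symm), fun hy => hy ▸ hx⟩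

end

end FinCard

/-! ### The skew monoidal category of collections -/

namespace CollTensor

open FinCard

variable {X Y : FinCard → Type w}

/-- Equality of elements of `X * Y` over finite cardinals which are only propositionally equal. -/
theorem heq {c c' : FinCard} (hc : c.card = c'.card) {a : CollTensor X Y c}
    {b : CollTensor X Y c'} (hd : a.cod.card = b.cod.card)
    (hf : ∀ t, (fn a.hom t).val = (fn b.hom (Fin.cast hc t)).val) (ho : a.outer ≍ b.outer)
    (hi : ∀ i : Fin a.cod.card, a.inner i ≍ b.inner (Fin.cast hd i)) : a ≍ b := by
  obtain ⟨c⟩ := c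
  obtain ⟨c'⟩ := c'
  obtain ⟨⟨d⟩, φ, x, y⟩ := a
  obtain ⟨⟨d'⟩, φ', x', y'⟩ := b
  dsimp only at hc hd
  subst hc hd
  obtain rfl : φ = φ' := funext fun t => Fin.ext (hf t)
  obtain rfl := eq_of_heq ho
  obtain rfl : y = y' := funext fun i => eq_of_heq (hi i)
  rfl

end CollTensor

namespace Coll

open FinCard

theorem hom_ext {X Y : FinCard → Type w} {f g : X ⟶ Y} (h : ∀ c x, f c x = g c x) : f = g :=
  funext fun c => ConcreteCategory.hom_ext _ _ (h c)

theorem congr_heq {Y : FinCard → Type w} {n : ℕ} {k : Fin n → FinCard} (y : ∀ i, Y (k i))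
    {i j : Fin n} (h : i = j) : y i ≍ y j := by
  rw [h]

theorem apply_heq {X Y : FinCard → Type w} (f : X ⟶ Y) {c d : FinCard} (h : c = d) {x : X c}
    {y : X d} (hxy : x ≍ y) : f c x ≍ f d y := by
  subst h
  rw [eq_of_heq hxy]

theorem unit_heq {c d : FinCard} (h : c.card = d.card) (x : (Coll.{w} FinCard).unit c)
    (y : (Coll.{w} FinCard).unit d) : x ≍ y := by
  obtain rfl := FinCard.ext h
  exact heq_of_eq (Subsingleton.elim (α := ULift (PLift _)) _ _)

theorem isSkewMonoidal : (Coll.{w} FinCard).IsSkewMonoidal where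
  assoc_natural f g k := hom_ext fun c a => eq_of_heq <|
    CollTensor.heq rfl rfl (fun _ => rfl) HEq.rfl fun i =>
      CollTensor.heq rfl rfl (fun _ => rfl) HEq.rfl fun j =>
        (cast_heq _ _).trans (apply_heq k (fibre_fibreMap a.hom a.outer.hom i j).symm
          (cast_heq _ _).symm)
  left_natural f := hom_ext fun c a => eq_of_heq <|
    (cast_heq _ _).trans (apply_heq f (fibre_of_isTrivialObj a.hom a.outer.down.down _)
          (cast_heq _ _).symm)
  right_natural f := hom_ext fun c a => rfl
  right_left := hom_ext fun c a => Subsingleton.elim (α := ULift (PLift _)) _ _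
  assoc_left X Y := hom_ext fun c ⟨d, φ, ⟨u, ψ, ⟨⟨hu⟩⟩, x⟩, y⟩ => eq_of_heq <| by
    refine (cast_heq _ _).trans ?_
    have hu1 : u.card = 1 := hu.1
    obtain ⟨e, he⟩ := fibIncl_of_card_eq_one ψ hu1 (Fin.cast hu1.symm 0)
    obtain ⟨e', he'⟩ := fibIncl_of_card_eq_one (φ ≫ ψ) hu1 (Fin.cast hu1.symm 0)
    refine CollTensor.heq e' e (fun t => ?_) (cast_heq _ _).symm fun i => ?_
    · have := fibIncl_fibreMap φ ψ (Fin.cast hu1.symm 0) t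
      rw [he, he'] at this
      exact congrArg Fin.val this
    · exact (cast_heq _ _).trans (congr_heq y (he i))
  right_assoc X Y := hom_ext fun c ⟨d, φ, x, y⟩ => eq_of_heq <| by
    refine CollTensor.heq rfl rfl (fun _ => rfl) HEq.rfl fun i =>
      CollTensor.heq rfl rfl (fun t => ?_) HEq.rfl fun j => ?_
    · exact congrArg Fin.val ((fibIncl_strictMono φ i).injective (fibIncl_fibreMap (𝟙 c) φ i t))
    · exact unit_heq (congrArg FinCard.card (congrArg (fun g => fibre g j)
        ((FibreStructure.R d i).map_id (Over.mk φ)))) _ _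
  right_assoc_left X Y := hom_ext fun c ⟨d, φ, x, y⟩ => eq_of_heq <| by
    refine CollTensor.heq rfl rfl (fun _ => rfl) HEq.rfl fun i => ?_
    exact (cast_heq _ _).trans ((cast_heq _ _).trans (congr_heq y (apply_fibIncl (𝟙 d) i _)))
  pentagon W X Y Z := hom_ext fun c ⟨d, φ, ⟨e, ψ, ⟨f, χ, p, x⟩, y⟩, z⟩ => eq_of_heq <| by
    refine CollTensor.heq rfl rfl (fun _ => rfl) HEq.rfl fun k => ?_
    -- The iterated fibres on both sides are fibres of `φ` and of `ψ`, by comparing inclusions.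
    have h1 : fibreMap φ (ψ ≫ χ) k ≫ fibreMap ψ χ k = fibreMap (φ ≫ ψ) χ k :=
      ((FibreStructure.R f k).map_comp (Over.homMk φ : Over.mk (φ ≫ ψ ≫ χ) ⟶ Over.mk (ψ ≫ χ))
        (Over.homMk ψ : Over.mk (ψ ≫ χ) ⟶ Over.mk χ)).symm
    refine CollTensor.heq rfl rfl (fun t => congrArg (fun g => (fn g t).val) h1) HEq.rfl
      fun i => ?_
    obtain ⟨e₁, h₁⟩ := fibIncl_fibIncl (φ ≫ ψ) χ k (fibreMap φ (ψ ≫ χ) k ≫ fibreMap ψ χ k)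
      (fun t => by rw [h1]; exact fibIncl_fibreMap (φ ≫ ψ) χ k t) i
    obtain ⟨e₂, h₂⟩ := fibIncl_fibIncl ψ χ k (fibreMap ψ χ k) (fibIncl_fibreMap ψ χ k) i
    refine HEq.trans (b := (⟨fibre ψ (fibIncl χ k i), fibreMap φ ψ (fibIncl χ k i),
      y (fibIncl χ k i), fun j => cast (congrArg Z (fibre_fibreMap φ ψ (fibIncl χ k i) j).symm)
        (z (fibIncl ψ (fibIncl χ k i) j))⟩ :
          CollTensor Y Z (fibre (φ ≫ ψ) (fibIncl χ k i)))) ?_ (cast_heq _ _).symm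
    refine CollTensor.heq e₁ e₂ (fun t => ?_) (cast_heq _ _) fun j => ?_
    · change (Fin.cast e₂ (fn (fibreMap (fibreMap φ (ψ ≫ χ) k) (fibreMap ψ χ k) i) t)).val =
        (fn (fibreMap φ ψ (fibIncl χ k i)) (Fin.cast e₁ t)).val
      refine congrArg Fin.val ((fibIncl_strictMono ψ _).injective ((h₂ _).symm.trans ?_))
      refine (congrArg (fibIncl (ψ ≫ χ) k) (fibIncl_fibreMap (fibreMap φ (ψ ≫ χ) k)
        (fibreMap ψ χ k) i t)).trans ?_
      refine (fibIncl_fibreMap φ (ψ ≫ χ) k _).trans ?_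
      refine (congrArg (fn φ) (h₁ t)).trans ?_
      exact (fibIncl_fibreMap φ ψ (fibIncl χ k i) _).symm
    · exact (cast_heq _ _).trans ((cast_heq _ _).trans ((congr_heq z (h₂ j)).trans
        (cast_heq _ _).symm))

end Coll

/-! ### Invertibility of the constraints of the substitution product -/

namespace SymColl

theorem act_symm_act (X : SymColl.{w}) {a b : ℕ} (σ : Fin a ≃ Fin b) (x : X.level a) :
    X.act σ.symm (X.act σ x) = x := by
  rw [← act_trans, Equiv.self_trans_symm, act_refl]

theorem act_act_symm (X : SymColl.{w}) {a b : ℕ} (σ : Fin a ≃ Fin b) (x : X.level b) :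
    X.act σ (X.act σ.symm x) = x := by
  rw [← act_trans, Equiv.symm_trans_self, act_refl]

/-- The action of a relabelling which preserves the order is a transport. -/
theorem act_heq (X : SymColl.{w}) {a b : ℕ} (σ : Fin a ≃ Fin b) (h : a = b)
    (hσ : ∀ t, σ t = Fin.cast h t) (x : X.level a) : X.act σ x ≍ x := by
  subst h
  obtain rfl : σ = Equiv.refl _ := Equiv.ext hσ
  exact heq_of_eq (act_refl X x)

namespace SubstRep.Rel

variable {X Y : SymColl.{w}} {n : ℕ} {a b c : SubstRep X Y n}

theorem refl (a : SubstRep X Y n) : a.Rel a :=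
  ⟨Equiv.refl _, fun _ => Equiv.refl _, act_refl X _, fun _ => act_refl Y _, fun _ _ => rfl⟩

theorem trans (h : a.Rel b) (h' : b.Rel c) : a.Rel c := by
  obtain ⟨π, τ, h1, h2, h3⟩ := h
  obtain ⟨π', τ', h1', h2', h3'⟩ := h'
  refine ⟨π.trans π', fun i => (τ i).trans (τ' (π i)), ?_, fun i => ?_, fun i t => ?_⟩
  · rw [act_trans, h1, h1']
  · refine (act_trans Y _ _ _).trans ?_
    rw [h2]
    exact h2' _
  · exact (h3' _ _).trans (h3 _ _)

theorem symm (h : a.Rel b) : b.Rel a := by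
  obtain ⟨π, τ, h1, h2, h3⟩ := h
  have key : ∀ i, ∃ τ' : Fin (b.k i) ≃ Fin (a.k (π.symm i)),
      Y.act τ' (b.inner i) = a.inner (π.symm i) ∧
        ∀ t, a.shuffle ⟨π.symm i, τ' t⟩ = b.shuffle ⟨i, t⟩ := by
    intro i
    obtain ⟨j, rfl⟩ := π.surjective i
    rw [π.symm_apply_apply]
    refine ⟨(τ j).symm, ?_, fun t => ?_⟩
    · rw [← h2, act_symm_act]
    · rw [← h3, Equiv.apply_symm_apply]
  choose τ' h2' h3' using key
  exact ⟨π.symm, τ', by rw [← h1, act_symm_act], h2', h3'⟩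

end SubstRep.Rel

/-- The relation which defines the substitution product is already an equivalence relation. -/
theorem subst.exact {X Y : SymColl.{w}} {n : ℕ} {a b : SubstRep X Y n}
    (h : subst.mk a = subst.mk b) : a.Rel b :=
  (Equivalence.eqvGen_iff ⟨SubstRep.Rel.refl, SubstRep.Rel.symm, SubstRep.Rel.trans⟩).1
    (Quot.eqvGen_exact h)

theorem subst.mk_surjective {X Y : SymColl.{w}} {n : ℕ} (a : (subst X Y).level n) :
    ∃ b, subst.mk b = a :=
  Quot.exists_rep a

theorem isIso_of_bijective {X Y : SymColl.{w}} (f : X ⟶ Y)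
    (h : ∀ n : FinPerm, Function.Bijective (f.app n)) : IsIso f := by
  have : ∀ n, IsIso (f.app n) := fun n => (isIso_iff_bijective _).2 (h n)
  exact NatIso.isIso_of_isIso_app f

/-- The representative of an element of `ℙ (1, -) ∘ X` with a single block, all of `Fin n`. -/
def single {X : SymColl.{w}} {n : ℕ} (x : X.level n) : SubstRep substUnit X n where
  m := 1
  k _ := n
  shuffle := Equiv.uniqueSigma fun _ : Fin 1 => Fin n
  outer := ⟨Equiv.refl _⟩
  inner _ := x

theorem substLeft_single {X : SymColl.{w}} {n : ℕ} (x : X.level n) :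
    (substLeft X).app ⟨n⟩ (subst.mk (single x)) = x := by
  refine Eq.trans ?_ (act_refl X x)
  change X.act ((blockEquiv (fun _ : Fin 1 => n) (Equiv.refl _)).trans
    (Equiv.uniqueSigma fun _ : Fin 1 => Fin n)) x = _
  exact congrArg (fun σ : Fin n ≃ Fin n => X.act σ x) (Equiv.ext fun _ => rfl)

/-- Every representative is equivalent to one with a single block. -/
theorem single_rel {X : SymColl.{w}} {n : ℕ} (a : SubstRep substUnit X n) :
    (single ((substLeft X).app ⟨n⟩ (subst.mk a))).Rel a := by
  refine ⟨a.outer.down, fun i : Fin 1 => match i with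
    | 0 => ((blockEquiv a.k a.outer.down).trans a.shuffle).symm,
    rfl, fun i : Fin 1 => ?_, fun (i : Fin 1) t => ?_⟩
  all_goals obtain rfl : i = 0 := Subsingleton.elim _ _
  · exact act_symm_act X _ _
  · exact Equiv.apply_symm_apply ((blockEquiv a.k a.outer.down).trans a.shuffle) t

theorem isIso_substLeft (X : SymColl.{w}) : IsIso (substLeft X) := by
  refine isIso_of_bijective _ fun n => ⟨?_, fun x => ?_⟩
  · rintro ⟨a⟩ ⟨b⟩ (h : (substLeft X).app n (subst.mk a) = (substLeft X).app n (subst.mk b))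
    refine subst.sound ((single_rel a).symm.trans ?_)
    rw [h]
    exact single_rel b
  · exact ⟨_, substLeft_single x⟩

theorem isIso_substRight (X : SymColl.{w}) : IsIso (substRight X) := by
  refine isIso_of_bijective _ fun n => ⟨fun x y h => ?_, fun z => ?_⟩
  · obtain ⟨π, τ, h1, -, h3⟩ := subst.exact h
    obtain rfl : π = Equiv.refl _ := Equiv.ext fun i => h3 i 0
    exact (act_refl X x).symm.trans h1
  · obtain ⟨⟨m, k, e, x, y⟩, rfl⟩ := subst.mk_surjective z
    let σ : Fin m ≃ Fin n.card := (Equiv.sigmaUnique (Fin m) fun _ => Fin 1).symm.trans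
      ((Equiv.sigmaCongrRight fun i => (y i).down).trans e)
    refine ⟨X.act σ x, subst.sound ⟨σ.symm, fun i => (y (σ.symm i)).down, ?_, fun i => rfl,
      fun i t => ?_⟩⟩
    · exact act_symm_act X σ x
    · obtain rfl : t = 0 := Subsingleton.elim _ _
      exact σ.apply_symm_apply i

/-- Equivalent images of two representatives of representatives are related by bijections at each of
the three levels, and these relate the original ones. -/
theorem injective_substAssoc (X Y Z : SymColl.{w}) (n : FinPerm) :
    Function.Injective ((substAssoc X Y Z).app n) := by
  rintro ⟨⟨p, l, f, ⟨⟨m, k, e, x, y⟩⟩, z⟩⟩ ⟨⟨p', l', f', ⟨⟨m', k', e', x', y'⟩⟩, z'⟩⟩ h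
  obtain ⟨π, τ, h1, h2, h3⟩ := subst.exact h
  choose σ ζ hy hz hs using fun i => subst.exact (h2 i)
  dsimp only [assocRep] at π τ h1 h2 h3 σ ζ hy hz hs
  -- The bijections between the blocks, and between the blocks inside them, assemble.
  let P : Fin p ≃ Fin p' := e.symm.trans ((Equiv.sigmaCongr π σ).trans e')
  have hP : ∀ i t, P (e ⟨i, t⟩) = e' ⟨π i, σ i t⟩ := by
    intro i t
    simp only [P, Equiv.trans_apply, Equiv.symm_apply_apply]
    rfl
  have key : ∀ a, ∃ Θ : Fin (l a) ≃ Fin (l' (P a)), Z.act Θ (z a) = z' (P a) ∧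
      ∀ s, f' ⟨P a, Θ s⟩ = f ⟨a, s⟩ := by
    intro a
    obtain ⟨⟨i, t⟩, rfl⟩ := e.surjective a
    rw [hP]
    refine ⟨ζ i t, hz i t, fun s => ?_⟩
    refine (assocShuffle_apply e' f' (π i) (σ i t) (ζ i t s)).symm.trans ?_
    refine (congrArg (fun r => assocShuffle e' f' ⟨π i, r⟩) (hs i t s)).trans ?_
    exact (h3 _ _).trans (assocShuffle_apply e f i t s)
  choose Θ h4 h5 using key
  exact subst.sound ⟨P, Θ, subst.sound ⟨π, σ, h1, hy, fun i t => (hP i t).symm⟩, h4, h5⟩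

/-- A family of elements of a collection can be reindexed along a bijection. -/
theorem exists_reindex (Z : SymColl.{w}) {ι : Type} {p : ℕ} (e : ι ≃ Fin p) (k : ι → ℕ)
    (z : ∀ q, Z.level (k q)) : ∃ (l : Fin p → ℕ) (θ : ∀ q, Fin (l (e q)) ≃ Fin (k q))
      (z' : ∀ a, Z.level (l a)), ∀ q, Z.act (θ q) (z' (e q)) = z q := by
  refine ⟨fun a => k (e.symm a), fun q => finCongr (congrArg k (e.symm_apply_apply q)),
    fun a => z (e.symm a), fun q => ?_⟩
  have key : ∀ {q q' : ι} (h : q = q'), Z.act (finCongr (congrArg k h)) (z q) = z q' := by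
    rintro q _ rfl
    exact act_refl Z (z q)
  exact key (e.symm_apply_apply q)

/-- Representatives of the inner elements assemble to a preimage, the index set of the middle level
being their disjoint union. -/
theorem surjective_substAssoc (X Y Z : SymColl.{w}) (n : FinPerm) :
    Function.Surjective ((substAssoc X Y Z).app n) := by
  rintro ⟨⟨m, r, g, x, v⟩⟩
  choose c hc using fun i => subst.mk_surjective (v i)
  let e : (Σ i, Fin (c i).m) ≃ Fin (∑ i, (c i).m) := finSigmaFinEquiv
  obtain ⟨l, θ, z, hz⟩ := exists_reindex Z e (fun q => (c q.1).k q.2) fun q => (c q.1).inner q.2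
  let f : (Σ a, Fin (l a)) ≃ Fin n.card :=
    (Equiv.sigmaCongrLeft (β := fun a => Fin (l a)) e).symm.trans <|
      (Equiv.sigmaCongrRight θ).trans <| (Equiv.sigmaAssoc fun i t => Fin ((c i).k t)).trans <|
        (Equiv.sigmaCongrRight fun i => (c i).shuffle).trans g
  have hf : ∀ i t s, f ⟨e ⟨i, t⟩, s⟩ = g ⟨i, (c i).shuffle ⟨t, θ ⟨i, t⟩ s⟩⟩ := by
    intro i t s
    have h : (Equiv.sigmaCongrLeft (β := fun a => Fin (l a)) e).symm ⟨e ⟨i, t⟩, s⟩ =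
        ⟨⟨i, t⟩, s⟩ := (Equiv.symm_apply_eq _).2 rfl
    simp only [f, Equiv.trans_apply, h]
    rfl
  refine ⟨subst.mk ⟨_, l, f, subst.mk ⟨m, _, e, x, fun i => (c i).outer⟩, z⟩, subst.sound ?_⟩
  let τ : ∀ i, Fin (∑ t, l (e ⟨i, t⟩)) ≃ Fin (r i) := fun i =>
    finSigmaFinEquiv.symm.trans
      ((Equiv.sigmaCongrRight fun t => θ ⟨i, t⟩).trans (c i).shuffle)
  have hτ : ∀ i t s, τ i (finSigmaFinEquiv ⟨t, s⟩) = (c i).shuffle ⟨t, θ ⟨i, t⟩ s⟩ := by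
    intro i t s
    simp only [τ, Equiv.trans_apply, Equiv.symm_apply_apply]
    rfl
  refine ⟨Equiv.refl _, τ, act_refl X x, fun i => ?_, fun i u => ?_⟩
  · refine Eq.trans (subst.sound ?_) (hc i)
    exact ⟨Equiv.refl _, fun t => θ ⟨i, t⟩, act_refl Y _, fun t => hz ⟨i, t⟩,
      fun t s => (hτ i t s).symm⟩
  · obtain ⟨⟨t, s⟩, rfl⟩ := finSigmaFinEquiv.surjective u
    refine (congrArg (fun v => g ⟨i, v⟩) (hτ i t s)).trans ?_
    exact (hf i t s).symm.trans (assocShuffle_apply e f i t s).symm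

theorem isIso_substAssoc (X Y Z : SymColl.{w}) : IsIso (substAssoc X Y Z) :=
  isIso_of_bijective _ fun n => ⟨injective_substAssoc X Y Z n, surjective_substAssoc X Y Z n⟩

end SymColl

/-! ### The comparison from collections to symmetric collections -/

namespace SymColl

open FinCard

/-- The blocks of a finite cardinal given by the fibres of a function. -/
noncomputable def fibShuffle {a b : FinCard} (φ : a ⟶ b) :
    (Σ i : Fin b.card, Fin (fibreCard φ i)) ≃ Fin a.card :=
  Equiv.ofBijective (fun s => fibIncl φ s.1 s.2) ⟨by
    rintro ⟨i, t⟩ ⟨j, s⟩ h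
    obtain rfl : i = j := (apply_fibIncl φ i t).symm.trans
      ((congrArg (fn φ) h).trans (apply_fibIncl φ j s))
    obtain rfl : t = s := (fibIncl_strictMono φ i).injective h
    rfl, fun x => by
    obtain ⟨t, ht⟩ := exists_fibIncl φ (x := x) rfl
    exact ⟨⟨_, t⟩, ht⟩⟩

/-- Blocks indexed by the codomain of `φ` and lying over their indices are, up to relabelling, the
fibres of `φ`. -/
theorem exists_fibre_equiv {a b : FinCard} (φ : a ⟶ b) {k : Fin b.card → ℕ}
    (s : (Σ i, Fin (k i)) ≃ Fin a.card) (hs : ∀ i t, fn φ (s ⟨i, t⟩) = i) :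
    ∃ θ : ∀ i, Fin (k i) ≃ Fin (fibreCard φ i), ∀ i t, fibIncl φ i (θ i t) = s ⟨i, t⟩ := by
  choose θ hθ using fun i t => exists_fibIncl φ (hs i t)
  refine ⟨fun i => Equiv.ofBijective (θ i) ⟨fun t t' h => ?_, fun u => ?_⟩, hθ⟩
  · have h1 : s ⟨i, t⟩ = s ⟨i, t'⟩ :=
      (hθ i t).symm.trans ((congrArg (fibIncl φ i) h).trans (hθ i t'))
    simpa using h1
  · obtain ⟨⟨j, t⟩, ht⟩ := s.surjective (fibIncl φ i u)
    obtain rfl : j = i := (hs j t).symm.trans ((congrArg (fn φ) ht).trans (apply_fibIncl φ i u))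
    exact ⟨t, (fibIncl_strictMono φ j).injective ((hθ j t).trans ht)⟩

/-- An element of `X * Y`, regarded as a representative of an element of `X ∘ Y`. -/
noncomputable def ofTensor {X Y : SymColl.{w}} {c : FinCard}
    (a : CollTensor (toFamily.obj X) (toFamily.obj Y) c) : SubstRep X Y c.card where
  m := a.cod.card
  k := fibreCard a.hom
  shuffle := fibShuffle a.hom
  outer := a.outer
  inner := a.inner

/-- The comparison `X * Y ⟶ X ∘ Y`. -/
noncomputable def quot (X Y : SymColl.{w}) :
    (Coll.{w} FinCard).tensorObj (toFamily.obj X) (toFamily.obj Y) ⟶ toFamily.obj (subst X Y) :=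
  fun _ => ↾fun a => subst.mk (ofTensor a)

/-- The comparison between the units. -/
def unitMap : (Coll.{w} FinCard).unit ⟶ toFamily.obj substUnit.{w} :=
  fun _ => ↾fun h => ⟨finCongr (h.down.down.1.symm)⟩

theorem quot_surjective (X Y : SymColl.{w}) (c : FinCard) : Function.Surjective (quot X Y c) := by
  rintro ⟨⟨m, k, s, x, y⟩⟩
  let φ : c ⟶ (⟨m⟩ : FinCard) := fun t => (s.symm t).1
  obtain ⟨θ, hθ⟩ := exists_fibre_equiv φ s fun i t => by
    change (s.symm (s ⟨i, t⟩)).1 = i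
    rw [Equiv.symm_apply_apply]
  refine ⟨⟨⟨m⟩, φ, x, fun i => Y.act (θ i) (y i)⟩, Eq.symm ?_⟩
  exact subst.sound (a := ⟨m, k, s, x, y⟩) (b := ofTensor _)
    ⟨Equiv.refl _, θ, act_refl X x, fun _ => rfl, hθ⟩

theorem unitMap_bijective (c : FinCard) : Function.Bijective (unitMap.{w} c) := by
  refine ⟨fun x y _ => Subsingleton.elim (α := ULift (PLift _)) _ _, fun ⟨σ⟩ => ?_⟩
  have h : c.card = 1 := by simpa using (Fintype.card_congr σ).symm
  refine ⟨⟨⟨isTrivialObj_of_card h⟩⟩, congrArg ULift.up (Equiv.ext fun t => Fin.ext ?_)⟩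
  have h1 : (σ t).val < c.card := (σ t).2
  have h2 : (finCongr h.symm t).val < c.card := (finCongr h.symm t).2
  change (finCongr h.symm t).val = (σ t).val
  omega

/-- The bijection underlying a fibrewise trivial morphism. -/
noncomputable def trivEquiv {c d : FinCard} (φ : c ⟶ d) (h : FibrewiseTrivial φ) :
    Fin c.card ≃ Fin d.card :=
  Equiv.ofBijective (fn φ) ((fibrewiseTrivial_iff_bijective φ).1 h)

theorem fibrewiseTrivial_of_equiv {c d : FinCard} (σ : Fin c.card ≃ Fin d.card) :
    FibrewiseTrivial (show c ⟶ d from σ) :=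
  (fibrewiseTrivial_iff_bijective _).2 σ.bijective

/-- The action of the unit `U` on a symmetric collection: a fibrewise trivial morphism acts by its
inverse bijection. -/
noncomputable def unitAct (X : SymColl.{w}) :
    (Coll.{w} FinCard).tensorObj (toFamily.obj X) (Coll.{w} FinCard).unit ⟶ toFamily.obj X :=
  fun _ => ↾fun a => X.act (trivEquiv a.hom fun i => (a.inner i).down.down).symm a.outer

/-- The element of `A * U` given by a bijection. -/
def tensorUnit {A : FinCard → Type w} {c d : FinCard} (σ : Fin c.card ≃ Fin d.card) (x : A d) :
    (Coll.{w} FinCard).tensorObj A (Coll.{w} FinCard).unit c :=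
  { cod := d, hom := σ, outer := x, inner := fun i => ⟨⟨fibrewiseTrivial_of_equiv σ i⟩⟩ }

theorem act_symm_congr (X : SymColl.{w}) {a b : ℕ} {σ τ : Fin a ≃ Fin b} (h : ∀ t, σ t = τ t)
    (x : X.level b) : X.act σ.symm x = X.act τ.symm x := by
  rw [Equiv.ext h]

theorem unitAct_tensorUnit (X : SymColl.{w}) {c d : FinCard} (σ : Fin c.card ≃ Fin d.card)
    (x : X.level d.card) : unitAct X c (tensorUnit (A := toFamily.obj X) σ x) = X.act σ.symm x := by
  exact act_symm_congr X (σ := trivEquiv (show c ⟶ d from σ) (fibrewiseTrivial_of_equiv σ))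
    (τ := σ) (fun _ => rfl) x

/-- The comparison coequalizes the two maps `(X * U) * Y ⟶ X * Y`. -/
theorem quot_condition (X Y : SymColl.{w}) :
    (Coll.{w} FinCard).tensorHom (unitAct X) (𝟙 (toFamily.obj Y)) ≫ quot X Y =
      ((Coll.{w} FinCard).assoc (toFamily.obj X) (Coll.{w} FinCard).unit (toFamily.obj Y) ≫
        (Coll.{w} FinCard).tensorHom (𝟙 (toFamily.obj X))
          ((Coll.{w} FinCard).left (toFamily.obj Y))) ≫ quot X Y :=
  Coll.hom_ext fun c ⟨d, φ, ⟨d', π, x, u⟩, y⟩ => subst.sound <| by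
    have hπ : FibrewiseTrivial π := fun i => (u i).down.down
    let σ := trivEquiv π hπ
    choose e he using fun i => fibIncl_of_square (g := φ) (g' := φ ≫ π) (u := fun t => t)
      strictMono_id (v := σ) σ.injective (fun _ => rfl) (i := i) rfl (fun x _ => ⟨x, rfl⟩)
    refine ⟨σ, fun i => finCongr (e i), act_act_symm X σ x, fun i => eq_of_heq ?_, fun i t => ?_⟩
    · refine (act_heq Y (finCongr (e i)) (e i) (fun _ => rfl) (y i)).trans ?_
      refine HEq.trans (Coll.congr_heq y (σ.injective ?_))
        ((cast_heq _ _).trans (cast_heq _ _)).symm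
      exact (apply_fibIncl π (σ i) _).symm
    · exact (he i t).symm

/-- A map which coequalizes the two maps `(X * U) * Y ⟶ X * Y` identifies elements with the same
image in `X ∘ Y`. -/
theorem eq_of_quot_eq {X Y : SymColl.{w}} {Z : FinCard → Type w}
    {f : (Coll.{w} FinCard).tensorObj (toFamily.obj X) (toFamily.obj Y) ⟶ Z}
    (hf : (Coll.{w} FinCard).tensorHom (unitAct X) (𝟙 (toFamily.obj Y)) ≫ f =
      ((Coll.{w} FinCard).assoc (toFamily.obj X) (Coll.{w} FinCard).unit (toFamily.obj Y) ≫
        (Coll.{w} FinCard).tensorHom (𝟙 (toFamily.obj X))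
          ((Coll.{w} FinCard).left (toFamily.obj Y))) ≫ f)
    {c : FinCard} {a b : CollTensor (toFamily.obj X) (toFamily.obj Y) c}
    (h : quot X Y c a = quot X Y c b) : f c a = f c b := by
  obtain ⟨d, φ, x, y⟩ := a
  obtain ⟨d', φ', x', y'⟩ := b
  obtain ⟨π, τ, h1, h2, h3⟩ := subst.exact h
  dsimp only [ofTensor] at π τ h1 h2 h3
  -- Both enumerations of corresponding fibres are increasing, so `τ` is order-preserving.
  have hτ : ∀ i, ∃ e : fibreCard φ i = fibreCard φ' (π i), ∀ t, τ i t = Fin.cast e t := by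
    intro i
    obtain ⟨e, he⟩ := strictMono_unique (fibIncl_strictMono φ i)
        (fibIncl_strictMono φ' (π i)) <| by
      ext x
      constructor
      · rintro ⟨t, rfl⟩
        exact ⟨τ i t, h3 i t⟩
      · rintro ⟨t, rfl⟩
        obtain ⟨s, rfl⟩ := (τ i).surjective t
        exact ⟨s, (h3 i s).symm⟩
    exact ⟨e, fun t => (fibIncl_strictMono φ' (π i)).injective ((h3 i t).trans (he t))⟩
  -- The relation is witnessed by the element `ω` of `(X * U) * Y`, whose two images are compared.
  have hone : ∀ j, fibreCard (show d ⟶ d' from π) j = 1 := fun j =>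
    (fibrewiseTrivial_of_equiv π j).1
  let ω : CollTensor ((Coll.{w} FinCard).tensorObj (toFamily.obj X) (Coll.{w} FinCard).unit)
      (toFamily.obj Y) c := ⟨d, φ, tensorUnit π x', y⟩
  refine Eq.trans (congrArg (f c) ?_) ((congrArg (fun g => g c ω) hf).trans (congrArg (f c) ?_))
  · refine eq_of_heq (CollTensor.heq rfl rfl (fun _ => rfl) (heq_of_eq ?_) fun _ => HEq.rfl)
    refine Eq.trans ?_ (unitAct_tensorUnit X π x').symm
    rw [← h1]
    exact (act_symm_act X π x).symm
  · refine eq_of_heq (CollTensor.heq rfl rfl (fun t => ?_) HEq.rfl fun j => ?_)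
    · obtain ⟨s, hs⟩ := exists_fibIncl φ (x := t) rfl
      refine congrArg Fin.val (a₁ := π (fn φ t)) (a₂ := fn φ' t) ?_
      exact (apply_fibIncl φ' _ (τ _ s)).symm.trans (congrArg (fn φ') ((h3 _ s).trans hs))
    · refine (cast_heq _ _).trans ((cast_heq _ _).trans ?_)
      obtain ⟨e, he⟩ := hτ (fibIncl (show d ⟶ d' from π) j (Fin.cast (hone j).symm 0))
      refine (act_heq Y _ e he _).symm.trans ((heq_of_eq (h2 _)).trans (Coll.congr_heq y' ?_))
      exact apply_fibIncl (show d ⟶ d' from π) j _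

/-- The action of `U` on `X ∘ Y` is induced by that on `Y`. -/
theorem quot_unitAct (X Y : SymColl.{w}) :
    (Coll.{w} FinCard).tensorHom (quot X Y) (𝟙 (Coll.{w} FinCard).unit) ≫ unitAct (subst X Y) =
      (Coll.{w} FinCard).assoc (toFamily.obj X) (toFamily.obj Y) (Coll.{w} FinCard).unit ≫
        (Coll.{w} FinCard).tensorHom (𝟙 (toFamily.obj X)) (unitAct Y) ≫ quot X Y :=
  Coll.hom_ext fun c ⟨d, ψ, ⟨d', φ, x, y⟩, u⟩ => subst.sound <| by
    have hψ : FibrewiseTrivial ψ := fun i => (u i).down.down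
    have hψ' : ∀ i, FibrewiseTrivial (fibreMap ψ φ i) := fun i j => by
      rw [fibre_fibreMap]
      exact hψ _
    refine ⟨Equiv.refl _, fun i => (trivEquiv (fibreMap ψ φ i) (hψ' i)).symm, act_refl X x,
      fun i => rfl, fun i t => ?_⟩
    refine ((Equiv.symm_apply_eq (trivEquiv ψ hψ)).2 ?_).symm
    refine Eq.trans ?_ (fibIncl_fibreMap ψ φ i _)
    exact congrArg (fibIncl φ i) ((trivEquiv (fibreMap ψ φ i) (hψ' i)).apply_symm_apply t).symm

theorem quot_assoc (X Y Z : SymColl.{w}) :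
    (Coll.{w} FinCard).tensorHom (quot X Y) (𝟙 (toFamily.obj Z)) ≫ quot (subst X Y) Z ≫
        toFamily.map (substAssoc X Y Z) =
      (Coll.{w} FinCard).assoc (toFamily.obj X) (toFamily.obj Y) (toFamily.obj Z) ≫
        (Coll.{w} FinCard).tensorHom (𝟙 (toFamily.obj X)) (quot Y Z) ≫ quot X (subst Y Z) :=
  Coll.hom_ext fun c ⟨d, φ, ⟨d', ψ, x, y⟩, z⟩ => subst.sound <| by
    obtain ⟨τ, hτ⟩ := exists_fibre_equiv (φ ≫ ψ) (assocShuffle (fibShuffle ψ) (fibShuffle φ))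
      fun i u => by
        obtain ⟨⟨t, s⟩, rfl⟩ := finSigmaFinEquiv.surjective u
        rw [assocShuffle_apply]
        exact (congrArg (fn ψ) (apply_fibIncl φ _ s)).trans (apply_fibIncl ψ i t)
    choose e he using fun i => fibIncl_fibIncl φ ψ i (fibreMap φ ψ i) (fibIncl_fibreMap φ ψ i)
    refine ⟨Equiv.refl _, τ, act_refl X x, fun i => subst.sound ?_, hτ⟩
    refine ⟨Equiv.refl _, fun t => finCongr (e i t).symm, act_refl Y _, fun t => eq_of_heq ?_,
      fun t s => ?_⟩
    · refine (act_heq Z _ (e i t).symm (fun _ => rfl) _).trans ?_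
      exact (cast_heq _ _).symm
    · refine (fibIncl_strictMono (φ ≫ ψ) i).injective ((he i t _).trans ?_)
      exact ((hτ i _).trans (assocShuffle_apply (fibShuffle ψ) (fibShuffle φ) i t s)).symm

theorem quot_left (X : SymColl.{w}) :
    (Coll.{w} FinCard).tensorHom unitMap (𝟙 (toFamily.obj X)) ≫ quot substUnit X ≫
        toFamily.map (substLeft X) = (Coll.{w} FinCard).left (toFamily.obj X) :=
  Coll.hom_ext fun c ⟨d, φ, ⟨⟨hd⟩⟩, y⟩ => eq_of_heq <| by
    have hd1 : d.card = 1 := hd.1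
    obtain ⟨e, he⟩ := fibIncl_of_card_eq_one φ hd1 (Fin.cast hd1.symm 0)
    refine HEq.trans ?_ (cast_heq _ _).symm
    exact act_heq X _ e he _

theorem quot_right (X : SymColl.{w}) :
    toFamily.map (substRight X) = (Coll.{w} FinCard).right (toFamily.obj X) ≫
      (Coll.{w} FinCard).tensorHom (𝟙 (toFamily.obj X)) unitMap ≫ quot X substUnit :=
  Coll.hom_ext fun c x => subst.sound <| by
    have h : ∀ i, fibreCard (𝟙 c) i = 1 := fun i => (OperadicCategory.fibrewiseTrivial_id c i).1
    exact ⟨Equiv.refl _, fun i => finCongr (h i).symm, act_refl X x, fun i => rfl,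
      fun i t => apply_fibIncl (𝟙 c) i _⟩

/-- The functor to underlying families of sets is lax monoidal, by the comparison maps. -/
noncomputable def laxStructure :
    SkewMonoidalStruct.LaxStructure substitution.{w} (Coll.{w} FinCard) toFamily where
  q := quot
  e := unitMap
  q_natural _ _ := rfl
  q_assoc := quot_assoc
  q_left := quot_left
  q_right := quot_right

theorem epi_of_surjective {A B : FinCard → Type w} {f : A ⟶ B}
    (h : ∀ c, Function.Surjective (f c)) : Epi f where
  left_cancellation g k hgk := Coll.hom_ext fun c x => by
    obtain ⟨x, rfl⟩ := h c x
    exact congrArg (fun m => m c x) hgk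

theorem tensorHom_surjective {A A' B B' : FinCard → Type w} {f : A ⟶ A'} {g : B ⟶ B'}
    (hf : ∀ c, Function.Surjective (f c)) (hg : ∀ c, Function.Surjective (g c)) (c : FinCard) :
    Function.Surjective ((Coll.{w} FinCard).tensorHom f g c) := by
  rintro ⟨d, φ, x, y⟩
  obtain ⟨x, rfl⟩ := hf _ x
  choose z hz using fun i => hg _ (y i)
  obtain rfl : (fun i => g _ (z i)) = y := funext hz
  exact ⟨⟨d, φ, x, z⟩, rfl⟩

theorem laxStructure_isEpi : laxStructure.{w}.IsEpi := by
  have hid : ∀ (A : FinCard → Type w) c, Function.Surjective (𝟙 A c) := fun A c x => ⟨x, rfl⟩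
  have he : ∀ c, Function.Surjective (unitMap.{w} c) := fun c => (unitMap_bijective c).2
  exact
    { e := epi_of_surjective he
      e_left := fun X => epi_of_surjective (tensorHom_surjective he (hid _))
      e_left_left := fun X Y =>
        epi_of_surjective (tensorHom_surjective (tensorHom_surjective he (hid _)) (hid _))
      q := fun X Y => epi_of_surjective (quot_surjective X Y)
      q_left := fun X Y Z => epi_of_surjective (tensorHom_surjective (quot_surjective X Y) (hid _))
      q_left_left := fun X Y Z W => epi_of_surjective
        (tensorHom_surjective (tensorHom_surjective (quot_surjective X Y) (hid _)) (hid _)) }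

instance : toFamily.{w}.Faithful where
  map_injective h := NatTrans.ext (funext fun n => congrFun h ⟨n.card⟩)

theorem isMonoidal_substitution : substitution.{w}.IsMonoidal where
  __ := laxStructure.isSkewMonoidal laxStructure_isEpi Coll.isSkewMonoidal
  isIso_assoc := isIso_substAssoc
  isIso_left := isIso_substLeft
  isIso_right := isIso_substRight

end SymColl

/-! ### Modules over the unit are symmetric collections -/

namespace SymColl

open FinCard

/-- The symmetric collection given by a `U`-module: a bijection acts through the fibrewise trivial
morphism given by its inverse. -/
def ofModule : (Coll.{w} FinCard).UnitModule ⥤ SymColl.{w} where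
  obj M :=
    { obj n := M.X ⟨n.card⟩
      map {n n'} σ := ↾fun x => M.act ⟨n'.card⟩
        (tensorUnit (c := ⟨n'.card⟩) (d := ⟨n.card⟩) (show Fin n.card ≃ Fin n'.card from σ).symm x)
      map_id n := by
        ext x
        exact congrArg (fun g => g ⟨n.card⟩ x) M.right_act
      map_comp {n n' n''} σ τ := by
        ext x
        exact (congrArg (fun g => g ⟨n''.card⟩ (tensorUnit (c := ⟨n''.card⟩) (d := ⟨n'.card⟩)
          (show Fin n'.card ≃ Fin n''.card from τ).symm (tensorUnit (c := ⟨n'.card⟩) (d := ⟨n.card⟩)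
            (show Fin n.card ≃ Fin n'.card from σ).symm x))) M.act_act).symm }
  map {M N} f :=
    { app n := f.hom ⟨n.card⟩
      naturality n n' σ := by
        ext x
        exact congrArg (fun g => g ⟨n'.card⟩
          (tensorUnit (c := ⟨n'.card⟩) (d := ⟨n.card⟩) (show Fin n.card ≃ Fin n'.card from σ).symm
            x)) f.act_hom }

theorem unitAct_natural {X Y : SymColl.{w}} (f : X ⟶ Y) :
    unitAct X ≫ toFamily.map f =
      (Coll.{w} FinCard).tensorHom (toFamily.map f) (𝟙 (Coll.{w} FinCard).unit) ≫ unitAct Y :=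
  Coll.hom_ext fun _ _ => act_app f _ _

/-- A map of underlying families which respects the actions of `U` is a map of symmetric
collections. -/
def homOfUnitAct {X Y : SymColl.{w}} (g : toFamily.obj X ⟶ toFamily.obj Y)
    (hg : unitAct X ≫ g =
      (Coll.{w} FinCard).tensorHom g (𝟙 (Coll.{w} FinCard).unit) ≫ unitAct Y) : X ⟶ Y where
  app n := g ⟨n.card⟩
  naturality n n' σ := by
    ext x
    have h := congrArg (fun k => k ⟨n'.card⟩
      (tensorUnit (c := ⟨n'.card⟩) (d := ⟨n.card⟩) (show Fin n.card ≃ Fin n'.card from σ).symm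
        x)) hg
    have h1 := unitAct_tensorUnit X (c := ⟨n'.card⟩) (d := ⟨n.card⟩)
      (show Fin n.card ≃ Fin n'.card from σ).symm x
    have h2 := unitAct_tensorUnit Y (c := ⟨n'.card⟩) (d := ⟨n.card⟩)
      (show Fin n.card ≃ Fin n'.card from σ).symm (g ⟨n.card⟩ x)
    exact (congrArg (g ⟨n'.card⟩) h1).symm.trans (h.trans h2)

/-- The `U`-module given by a symmetric collection. -/
noncomputable def toModule (X : SymColl.{w}) : (Coll.{w} FinCard).UnitModule where
  X := toFamily.obj X
  act := unitAct X
  act_act := Coll.hom_ext fun c ⟨d, φ, ⟨d', ψ, x, u⟩, v⟩ => by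
    refine (act_trans X (trivEquiv ψ fun i => (u i).down.down).symm
      (trivEquiv φ fun i => (v i).down.down).symm x).symm.trans ?_
    exact act_symm_congr X (σ := (trivEquiv φ fun i => (v i).down.down).trans
      (trivEquiv ψ fun i => (u i).down.down)) (by exact fun _ => rfl) x
  right_act := Coll.hom_ext fun c x => by
    refine Eq.trans ?_ (act_refl X x)
    exact act_symm_congr X (τ := Equiv.refl (Fin c.card)) (by exact fun _ => rfl) x

instance : ofModule.{w}.Faithful where
  map_injective h := SkewMonoidalStruct.UnitModule.Hom.ext
    (congrArg (fun k => toFamily.map k) h)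

instance : ofModule.{w}.Full where
  map_surjective f := ⟨⟨toFamily.map f, unitAct_natural f⟩, rfl⟩

/-- The symmetric collection of the `U`-module of a symmetric collection is the original one. -/
noncomputable def ofModuleToModule (X : SymColl.{w}) : ofModule.obj (toModule X) ≅ X :=
  NatIso.ofComponents (fun n => Iso.refl _) fun {n n'} σ => by
    ext x
    exact unitAct_tensorUnit X (c := ⟨n'.card⟩) (d := ⟨n.card⟩)
      (show Fin n.card ≃ Fin n'.card from σ).symm x

instance : ofModule.{w}.EssSurj where
  mem_essImage X := ⟨toModule X, ⟨ofModuleToModule X⟩⟩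

instance : ofModule.{w}.IsEquivalence where

/-- The factorization through `X ∘ Y` of a map out of `X * Y`, obtained by choosing preimages under
`q`. It is a factorization only when the map coequalizes the two maps from `(X * U) * Y`. -/
noncomputable def quotDesc {X Y : SymColl.{w}} {Z : FinCard → Type w}
    (f : (Coll.{w} FinCard).tensorObj (toFamily.obj X) (toFamily.obj Y) ⟶ Z) :
    toFamily.obj (subst X Y) ⟶ Z :=
  fun c => ↾fun x => f c (Function.surjInv (quot_surjective X Y c) x)

theorem quot_quotDesc {X Y : SymColl.{w}} {Z : FinCard → Type w}
    {f : (Coll.{w} FinCard).tensorObj (toFamily.obj X) (toFamily.obj Y) ⟶ Z}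
    (hf : (Coll.{w} FinCard).tensorHom (unitAct X) (𝟙 (toFamily.obj Y)) ≫ f =
      ((Coll.{w} FinCard).assoc (toFamily.obj X) (Coll.{w} FinCard).unit (toFamily.obj Y) ≫
        (Coll.{w} FinCard).tensorHom (𝟙 (toFamily.obj X))
          ((Coll.{w} FinCard).left (toFamily.obj Y))) ≫ f) :
    quot X Y ≫ quotDesc f = f :=
  Coll.hom_ext fun _ _ => eq_of_quot_eq hf (Function.surjInv_eq _ _)

/-- `X ∘ Y` is the coequalizer of the two maps `(X * U) * Y ⟶ X * Y`. -/
noncomputable def quotIsCoequalizer (X Y : SymColl.{w}) :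
    Limits.IsColimit (Limits.Cofork.ofπ (quot X Y) (quot_condition X Y)) :=
  have : Epi (quot X Y) := laxStructure_isEpi.q X Y
  Limits.Cofork.IsColimit.mk _ (fun s => quotDesc s.π) (fun s => quot_quotDesc s.condition)
    fun s m hm => by
      rw [← cancel_epi (quot X Y)]
      exact hm.trans (quot_quotDesc s.condition).symm

open SkewMonoidalStruct

/-- The tensor product of modules, as the module given by the substitution product. -/
noncomputable def moduleTensor (M N : (Coll.{w} FinCard).UnitModule) :
    (Coll.{w} FinCard).UnitModule :=
  toModule (subst (ofModule.obj M) (ofModule.obj N))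

/-- The module map with a given underlying map of symmetric collections. -/
def moduleHom {M N : (Coll.{w} FinCard).UnitModule} (f : ofModule.obj M ⟶ ofModule.obj N) : M ⟶ N :=
  ⟨toFamily.map f, unitAct_natural f⟩

/-- The symmetric collection of the module `U` is the unit for substitution. -/
def unitHom : ofModule.obj ((Coll.{w} FinCard).unitModule Coll.isSkewMonoidal) ⟶ substUnit.{w} :=
  homOfUnitAct unitMap (Coll.hom_ext fun _ _ =>
    Subsingleton.elim (α := ULift (Fin 1 ≃ Fin _)) _ _)

instance : IsIso unitHom.{w} :=
  isIso_of_bijective _ fun n => unitMap_bijective ⟨n.card⟩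

/-- The unit for substitution, as the symmetric collection of the module `U`. -/
noncomputable def unitIso :
    substUnit.{w} ≅ ofModule.obj ((Coll.{w} FinCard).unitModule Coll.isSkewMonoidal) :=
  (asIso unitHom).symm

theorem unitMap_unitIso : unitMap ≫ toFamily.map unitIso.{w}.hom = 𝟙 _ :=
  congrArg (fun f => toFamily.map f) unitIso.inv_hom_id

/-- A right normalization of the skew monoidal category of collections, with the substitution
product as tensor product. -/
noncomputable def rightNormalization :
    (Coll.{w} FinCard).RightNormalization Coll.isSkewMonoidal where
  tensorObj M N := moduleTensor M N
  p M N := quot (ofModule.obj M) (ofModule.obj N)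
  p_condition M N := quot_condition (ofModule.obj M) (ofModule.obj N)
  p_isCoequalizer M N := ⟨quotIsCoequalizer (ofModule.obj M) (ofModule.obj N)⟩
  p_act M N := quot_unitAct (ofModule.obj M) (ofModule.obj N)
  tensorHom f g := moduleHom ((ofModuleToModule _).hom ≫
    substMap (ofModule.map f) (ofModule.map g) ≫ (ofModuleToModule _).inv)
  p_tensorHom f g := rfl
  assoc M N K := moduleHom ((ofModuleToModule _).hom ≫
    substMap (ofModuleToModule _).hom (𝟙 _) ≫ substAssoc _ _ _ ≫
      substMap (𝟙 _) (ofModuleToModule _).inv ≫ (ofModuleToModule _).inv)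
  p_assoc M N K := Coll.hom_ext fun c a => congrArg
    (fun g => (substMap (𝟙 (ofModule.obj M)) (ofModuleToModule _).inv).app ⟨c.card⟩ (g c a))
    (quot_assoc (ofModule.obj M) (ofModule.obj N) (ofModule.obj K))
  left M := moduleHom ((ofModuleToModule _).hom ≫ substMap unitIso.inv (𝟙 _) ≫
    substLeft (ofModule.obj M))
  p_left M := Coll.hom_ext fun c a => congrArg (fun g => g c a) (quot_left (ofModule.obj M))
  right M := moduleHom (substRight (ofModule.obj M) ≫ substMap (𝟙 _) unitIso.hom ≫
    (ofModuleToModule _).inv)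
  right_eq M := by
    change toFamily.map (substRight (ofModule.obj M)) ≫
      toFamily.map (substMap (𝟙 (ofModule.obj M)) unitIso.hom) = _
    rw [quot_right]
    change (Coll FinCard).right (toFamily.obj (ofModule.obj M)) ≫
      (Coll FinCard).tensorHom (𝟙 (toFamily.obj (ofModule.obj M)))
        (unitMap ≫ toFamily.map unitIso.hom) ≫ quot (ofModule.obj M) (ofModule.obj _) = _
    rw [unitMap_unitIso]
    rfl

end SymColl

/-! ### Right normalizations and the substitution product -/

namespace SymColl

open FinCard SkewMonoidalStruct

/-- A map `X * Y ⟶ Z` which coequalizes the two maps from `(X * U) * Y` and respects the actions of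
`U` factors through a map `X ∘ Y ⟶ Z` of symmetric collections. -/
noncomputable def quotHom {X Y Z : SymColl.{w}}
    (p : (Coll.{w} FinCard).tensorObj (toFamily.obj X) (toFamily.obj Y) ⟶ toFamily.obj Z)
    (hp : (Coll.{w} FinCard).tensorHom (unitAct X) (𝟙 (toFamily.obj Y)) ≫ p =
      ((Coll.{w} FinCard).assoc (toFamily.obj X) (Coll.{w} FinCard).unit (toFamily.obj Y) ≫
        (Coll.{w} FinCard).tensorHom (𝟙 (toFamily.obj X))
          ((Coll.{w} FinCard).left (toFamily.obj Y))) ≫ p)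
    (hp' : (Coll.{w} FinCard).tensorHom p (𝟙 (Coll.{w} FinCard).unit) ≫ unitAct Z =
      (Coll.{w} FinCard).assoc (toFamily.obj X) (toFamily.obj Y) (Coll.{w} FinCard).unit ≫
        (Coll.{w} FinCard).tensorHom (𝟙 (toFamily.obj X)) (unitAct Y) ≫ p) : subst X Y ⟶ Z :=
  homOfUnitAct (quotDesc p) <| by
    have : Epi ((Coll.{w} FinCard).tensorHom (quot X Y) (𝟙 (Coll.{w} FinCard).unit)) :=
      epi_of_surjective (tensorHom_surjective (quot_surjective _ _) fun c x => ⟨x, rfl⟩)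
    rw [← cancel_epi ((Coll.{w} FinCard).tensorHom (quot X Y) (𝟙 (Coll.{w} FinCard).unit)),
      reassoc_of% quot_unitAct, quot_quotDesc hp, ← hp',
      ← reassoc_of% (Coll.{w} FinCard).tensor_comp, quot_quotDesc hp, Category.comp_id]

/-- If `p : X * Y ⟶ Z` is also a coequalizer, then `X ∘ Y ⟶ Z` is invertible. -/
theorem isIso_of_quot_comp {X Y Z : SymColl.{w}} {f : subst X Y ⟶ Z}
    {p : (Coll.{w} FinCard).tensorObj (toFamily.obj X) (toFamily.obj Y) ⟶ toFamily.obj Z}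
    (hf : quot X Y ≫ toFamily.map f = p) (hp : Epi p)
    (g : toFamily.obj Z ⟶ toFamily.obj (subst X Y)) (hg : p ≫ g = quot X Y) : IsIso f := by
  have : Epi (quot X Y) := laxStructure_isEpi.q X Y
  have h1 : toFamily.map f ≫ g = 𝟙 _ := by
    rw [← cancel_epi (quot X Y), reassoc_of% hf, hg, Category.comp_id]
  have h2 : g ≫ toFamily.map f = 𝟙 _ := by
    rw [← cancel_epi p, reassoc_of% hg, hf, Category.comp_id]
  refine isIso_of_bijective _ fun n => Function.bijective_iff_has_inverse.2 ⟨g ⟨n.card⟩, ?_, ?_⟩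
  · exact fun x => congrArg (fun k => k ⟨n.card⟩ x) h1
  · exact fun x => congrArg (fun k => k ⟨n.card⟩ x) h2

variable (N : (Coll.{w} FinCard).RightNormalization Coll.isSkewMonoidal)

/-- The underlying functor of a right normalization is lax monoidal, by the maps `p`. -/
def normalizationLax :
    LaxStructure N.toSkewMonoidalStruct (Coll.{w} FinCard) (ofModule ⋙ toFamily) where
  q M K := N.p M K
  e := 𝟙 _
  q_natural f g := N.p_tensorHom f g
  q_assoc M K J := N.p_assoc M K J
  q_left M := N.p_left M
  q_right M := N.right_eq M

/-- The comparison from the substitution product to the tensor product of a right normalization,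
both being coequalizers of the same maps. -/
noncomputable def comparison (M K : (Coll.{w} FinCard).UnitModule) :
    subst (ofModule.obj M) (ofModule.obj K) ⟶ ofModule.obj (N.tensorObj M K) :=
  quotHom (X := ofModule.obj M) (Y := ofModule.obj K) (Z := ofModule.obj (N.tensorObj M K))
    (N.p M K) (N.p_condition M K) (N.p_act M K)

theorem quot_comparison (M K : (Coll.{w} FinCard).UnitModule) :
    quot (ofModule.obj M) (ofModule.obj K) ≫ toFamily.map (comparison N M K) = N.p M K :=
  quot_quotDesc (X := ofModule.obj M) (Y := ofModule.obj K) (N.p_condition M K)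

theorem isIso_comparison (M K : (Coll.{w} FinCard).UnitModule) : IsIso (comparison N M K) := by
  obtain ⟨hc⟩ := N.p_isCoequalizer M K
  obtain ⟨g, hg⟩ := Limits.Cofork.IsColimit.desc' hc
    (quot (ofModule.obj M) (ofModule.obj K)) (quot_condition (ofModule.obj M) (ofModule.obj K))
  exact isIso_of_quot_comp (quot_comparison N M K) ⟨fun _ _ h => N.p_cancel h⟩ g hg

/-- The functor from `U`-modules to symmetric collections is strong monoidal, for any right
normalization. -/
noncomputable def ofModuleLax : LaxStructure N.toSkewMonoidalStruct substitution.{w} ofModule :=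
  laxStructure.factor laxStructure_isEpi (normalizationLax N) (comparison N) unitIso.hom
    (quot_comparison N) unitMap_unitIso

theorem isMonoidal_normalization : N.toSkewMonoidalStruct.IsMonoidal :=
  (ofModuleLax N).isMonoidal (isIso_comparison N) unitIso.isIso_hom
    isMonoidal_substitution

/-- The strong monoidal structure on the functor from `U`-modules to symmetric collections. -/
@[reducible]
noncomputable def ofModuleMonoidal :
    letI := (isMonoidal_normalization N).monoidalCategory
    letI := isMonoidal_substitution.{w}.monoidalCategory
    ofModule.{w}.Monoidal :=
  (ofModuleLax N).monoidal (isIso_comparison N) unitIso.isIso_hom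
    (isMonoidal_normalization N) isMonoidal_substitution

end SymColl

/-! ### Monoids for the substitution product are symmetric operads -/

namespace SymColl

/-- The representative of an element of `(X ∘ Y) (k₁ + ⋯ + k_m)` with consecutive blocks. -/
def SubstRep.std {X Y : SymColl.{w}} {m : ℕ} (k : Fin m → ℕ) (x : X.level m)
    (y : ∀ i, Y.level (k i)) : SubstRep X Y (∑ i, k i) where
  m := m
  k := k
  shuffle := finSigmaFinEquiv
  outer := x
  inner := y

theorem subst.mk_eq_act_std {X Y : SymColl.{w}} {n : ℕ} (a : SubstRep X Y n) :
    subst.mk a = (subst X Y).act (finSigmaFinEquiv.symm.trans a.shuffle)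
      (subst.mk (SubstRep.std a.k a.outer a.inner)) :=
  subst.sound ⟨Equiv.refl _, fun _ => Equiv.refl _, act_refl X _, fun _ => act_refl Y _, fun _ _ =>
    congrArg a.shuffle (finSigmaFinEquiv.symm_apply_apply _)⟩

theorem app_mk {X Y Z : SymColl.{w}} (f : subst X Y ⟶ Z) {n : ℕ} (a : SubstRep X Y n) :
    f.app ⟨n⟩ (subst.mk a) = Z.act (finSigmaFinEquiv.symm.trans a.shuffle)
      (f.app ⟨_⟩ (subst.mk (SubstRep.std a.k a.outer a.inner))) := by
  rw [subst.mk_eq_act_std a, act_app]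

/-- A map out of `X ∘ Y` is determined by its values on consecutive blocks, every
representative being a relabelling of one of these. -/
theorem subst_hom_ext {X Y Z : SymColl.{w}} {f g : subst X Y ⟶ Z}
    (h : ∀ {m : ℕ} (k : Fin m → ℕ) (x : X.level m) (y : ∀ i, Y.level (k i)),
      f.app ⟨_⟩ (subst.mk (SubstRep.std k x y)) = g.app ⟨_⟩ (subst.mk (SubstRep.std k x y))) :
    f = g := by
  ext n x
  obtain ⟨a, rfl⟩ := subst.mk_surjective x
  exact (app_mk f a).trans ((congrArg _ (h _ _ _)).trans (app_mk g a).symm)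

theorem subst_subst_hom_ext {X Y Z W : SymColl.{w}} {f g : subst (subst X Y) Z ⟶ W}
    (h : ∀ {m : ℕ} (k : Fin m → ℕ) (l : Fin (∑ i, k i) → ℕ) (x : X.level m)
      (y : ∀ i, Y.level (k i)) (z : ∀ a, Z.level (l a)),
      f.app ⟨_⟩ (subst.mk (SubstRep.std l (subst.mk (SubstRep.std k x y)) z)) =
        g.app ⟨_⟩ (subst.mk (SubstRep.std l (subst.mk (SubstRep.std k x y)) z))) : f = g := by
  refine subst_hom_ext fun {p} l x z => ?_
  obtain ⟨a, rfl⟩ := subst.mk_surjective x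
  -- Relabelling the index set `Fin p` of the outer blocks makes the inner blocks consecutive.
  let π : Fin (∑ i, a.k i) ≃ Fin p := finSigmaFinEquiv.symm.trans a.shuffle
  have hrel : SubstRep.Rel (X := subst X Y) (Y := Z)
      ⟨_, fun i => l (π i), (Equiv.sigmaCongrLeft (β := fun i => Fin (l i)) π).trans
        finSigmaFinEquiv, subst.mk (SubstRep.std a.k a.outer a.inner), fun i => z (π i)⟩
      (SubstRep.std l (subst.mk a) z) :=
    ⟨π, fun _ => Equiv.refl _, (subst.mk_eq_act_std a).symm, fun _ => act_refl Z _, fun _ _ => rfl⟩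
  rw [← subst.sound hrel, app_mk f, app_mk g]
  exact congrArg _ (h _ _ _ _ _)

theorem substUnit_hom_ext {X : SymColl.{w}} {f g : substUnit ⟶ X}
    (h : f.app ⟨1⟩ ⟨Equiv.refl _⟩ = g.app ⟨1⟩ ⟨Equiv.refl _⟩) : f = g := by
  ext n ⟨σ⟩
  have h1 := act_app f σ ⟨Equiv.refl _⟩
  have h2 := act_app g σ ⟨Equiv.refl _⟩
  exact h1.trans ((congrArg _ h).trans h2.symm)

/-- The monoidal category of symmetric collections. -/
@[reducible]
noncomputable def substMonoidal : MonoidalCategory SymColl.{w} :=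
  isMonoidal_substitution.monoidalCategory

attribute [local instance] substMonoidal

open MonObj

section MonObj

variable (P : SymColl.{w}) [MonObj P]

/-- The identity of a monoid for the substitution product, as a map from `ℙ (1, -)`. -/
def monOne : substUnit.{w} ⟶ P := MonObj.one (X := P)

/-- The multiplication of a monoid for the substitution product. -/
def monMul : subst P P ⟶ P := MonObj.mul (X := P)

theorem monOne_mul : substMap (monOne P) (𝟙 P) ≫ monMul P = substLeft P :=
  MonObj.one_mul P

theorem monMul_one : substRight P ≫ substMap (𝟙 P) (monOne P) ≫ monMul P = 𝟙 P := by
  have := isIso_substRight P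
  have h : substMap (𝟙 P) (monOne P) ≫ monMul P = inv (substRight P) := MonObj.mul_one P
  rw [h, IsIso.hom_inv_id]

theorem monMul_assoc : substMap (monMul P) (𝟙 P) ≫ monMul P =
    substAssoc P P P ≫ substMap (𝟙 P) (monMul P) ≫ monMul P :=
  MonObj.mul_assoc P

/-- The symmetric operad given by a monoid for the substitution product. -/
def monOperad : SymOperad.{w} where
  P := P
  one := (monOne P).app ⟨1⟩ ⟨Equiv.refl _⟩
  comp k x y := (monMul P).app ⟨_⟩ (subst.mk (SubstRep.std k x y))
  comp_act k k' τ x y := by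
    refine Eq.trans ?_ (app_mk (monMul P)
      ⟨_, k, (Equiv.sigmaCongrRight τ).trans finSigmaFinEquiv, x, y⟩)
    refine congrArg ((monMul P).app _) (subst.sound ?_).symm
    exact ⟨Equiv.refl _, τ, act_refl P x, fun _ => rfl, fun _ _ => rfl⟩
  act_comp k π x y := by
    refine Eq.trans ?_ (app_mk (monMul P) ⟨_, fun i => k (π i),
      (Equiv.sigmaCongrLeft (β := fun i => Fin (k i)) π).trans finSigmaFinEquiv, x,
      fun i => y (π i)⟩)
    refine congrArg ((monMul P).app _) (subst.sound ?_).symm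
    exact ⟨π, fun _ => Equiv.refl _, rfl, fun _ => act_refl P _, fun _ _ => rfl⟩
  one_comp {n} x := by
    refine (app_mk (monMul P) ⟨1, fun _ => n, Equiv.uniqueSigma fun _ : Fin 1 => Fin n, _,
      fun _ => x⟩).symm.trans ?_
    exact (congrArg (fun f => f.app ⟨n⟩ (subst.mk (single x))) (monOne_mul P)).trans
      (substLeft_single x)
  comp_one {n} x := by
    refine (app_mk (monMul P) ⟨n, fun _ => 1, Equiv.sigmaUnique (Fin n) fun _ => Fin 1, x,
      fun _ => _⟩).symm.trans ?_
    exact congrArg (fun f => f.app ⟨n⟩ x) (monMul_one P)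
  comp_assoc {m} k l x y z := by
    have h := congrArg (fun f => f.app ⟨_⟩
      (subst.mk (SubstRep.std l (subst.mk (SubstRep.std k x y)) z))) (monMul_assoc P)
    refine (congrArg _ (h.trans (app_mk (monMul P) _))).trans ?_
    rw [← act_trans]
    refine Eq.trans ?_ (act_refl P _)
    refine congrArg (fun σ => P.act σ _) (Equiv.ext fun t => ?_)
    exact (congrArg finSigmaFinEquiv ((assocShuffle finSigmaFinEquiv
      finSigmaFinEquiv).symm_apply_apply _)).trans (finSigmaFinEquiv.apply_symm_apply t)

end MonObj

/-- The functor from monoids to symmetric operads. -/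
def monToOperad : Mon SymColl.{w} ⥤ SymOperad.{w} where
  obj M := monOperad M.X
  map {M N} f :=
    { hom := f.hom
      hom_one := congrArg (fun g => g.app ⟨1⟩ ⟨Equiv.refl _⟩) (IsMonHom.one_hom f.hom)
      hom_comp := fun k x y => congrArg (fun g => g.app ⟨_⟩ (subst.mk (SubstRep.std k x y)))
        (IsMonHom.mul_hom f.hom) }

instance : monToOperad.{w}.Faithful where
  map_injective h := Mon.Hom.ext (congrArg SymOperad.Hom.hom h)

instance : monToOperad.{w}.Full where
  map_surjective {M N} f := by
    refine ⟨Mon.Hom.mk' f.hom ?_ ?_, rfl⟩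
    · exact substUnit_hom_ext f.hom_one
    · exact subst_hom_ext (f := monMul M.X ≫ f.hom) (g := substMap f.hom f.hom ≫ monMul N.X)
        f.hom_comp

section SymOperad

variable (A : SymOperad.{w})

/-- The identity of an operad, as a map from `ℙ (1, -)`. -/
def operadOne : substUnit ⟶ A.P where
  app n := ↾fun σ => A.P.act σ.down A.one
  naturality n n' σ := by
    ext τ
    exact act_trans A.P τ.down (show Fin n.card ≃ Fin n'.card from σ) A.one

/-- The composition of an operad, as a map from the substitution product. -/
def operadMul : subst A.P A.P ⟶ A.P where
  app n := ↾(Quot.lift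
    (fun a => A.P.act (finSigmaFinEquiv.symm.trans a.shuffle) (A.comp a.k a.outer a.inner)) (by
      rintro ⟨m, k, s, x, y⟩ ⟨m', k', s', x', y'⟩ ⟨π, τ, h1, h2, h3⟩
      dsimp only at π τ h1 h2 h3 ⊢
      subst h1
      obtain h2 : (fun i => A.P.act (τ i) (y i)) = fun i => y' (π i) := funext h2
      rw [A.act_comp, ← h2, A.comp_act k (fun i => k' (π i)), ← act_trans, ← act_trans]
      refine congrArg (fun σ => A.P.act σ _) (Equiv.ext fun u => ?_)
      obtain ⟨⟨i, t⟩, rfl⟩ := finSigmaFinEquiv.surjective u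
      simp only [Equiv.trans_apply, Equiv.symm_apply_apply]
      exact (h3 i t).symm))
  naturality n n' σ := by
    ext ⟨a⟩
    exact act_trans A.P (finSigmaFinEquiv.symm.trans a.shuffle)
      (show Fin n.card ≃ Fin n'.card from σ) _

theorem operadMul_mk {n : ℕ} (a : SubstRep A.P A.P n) : (operadMul A).app ⟨n⟩ (subst.mk a) =
    A.P.act (finSigmaFinEquiv.symm.trans a.shuffle) (A.comp a.k a.outer a.inner) :=
  rfl

theorem operadMul_std {m : ℕ} (k : Fin m → ℕ) (x : A.P.level m) (y : ∀ i, A.P.level (k i)) :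
    (operadMul A).app ⟨_⟩ (subst.mk (SubstRep.std k x y)) = A.comp k x y := by
  refine (operadMul_mk A _).trans ?_
  refine (congrArg (fun σ => A.P.act σ (A.comp k x y)) ?_).trans (act_refl A.P _)
  exact Equiv.symm_trans_self _

theorem operadOne_mul : substMap (operadOne A) (𝟙 A.P) ≫ operadMul A = substLeft A.P := by
  ext n a
  obtain ⟨a, rfl⟩ := subst.mk_surjective a
  rw [← subst.sound (single_rel a)]
  generalize (substLeft A.P).app ⟨n.card⟩ (subst.mk a) = x
  refine Eq.trans ?_ (substLeft_single x).symm
  refine Eq.trans ?_ (A.one_comp x)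
  exact congrArg (fun e => A.P.act _ (A.comp (fun _ : Fin 1 => n.card) e fun _ => x))
    (act_refl A.P A.one)

theorem operadMul_one : substRight A.P ≫ substMap (𝟙 A.P) (operadOne A) ≫ operadMul A = 𝟙 A.P := by
  ext n x
  refine Eq.trans ?_ (A.comp_one x)
  exact congrArg (fun e => A.P.act _ (A.comp (fun _ : Fin n.card => 1) x fun _ => e))
    (act_refl A.P A.one)

theorem operadMul_assoc : substMap (operadMul A) (𝟙 A.P) ≫ operadMul A =
    substAssoc A.P A.P A.P ≫ substMap (𝟙 A.P) (operadMul A) ≫ operadMul A := by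
  refine subst_subst_hom_ext fun {m} k l x y z => ?_
  have h : ∀ i, (operadMul A).app ⟨_⟩ (subst.mk (SubstRep.std
      (fun t => l (finSigmaFinEquiv ⟨i, t⟩)) (y i) fun t => z (finSigmaFinEquiv ⟨i, t⟩))) =
        A.comp _ (y i) fun t => z (finSigmaFinEquiv ⟨i, t⟩) := fun i => operadMul_std A _ _ _
  refine (operadMul_std A l _ z).trans ?_
  refine (congrArg (fun u => A.comp l u z) (operadMul_std A k x y)).trans ?_
  refine Eq.trans ?_ (congrArg (fun u => A.P.act (finSigmaFinEquiv.symm.trans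
    (assocShuffle finSigmaFinEquiv finSigmaFinEquiv))
      (A.comp (fun i => ∑ t, l (finSigmaFinEquiv ⟨i, t⟩)) x u)) (funext h)).symm
  rw [← A.comp_assoc, ← act_trans]
  refine (act_refl A.P _).symm.trans (congrArg (fun σ => A.P.act σ _) (Equiv.ext fun u => ?_))
  simp

/-- The monoid given by a symmetric operad. -/
@[reducible]
noncomputable def operadMonObj : MonObj A.P where
  one := operadOne A
  mul := operadMul A
  one_mul := operadOne_mul A
  mul_one := by
    have := isIso_substRight A.P
    change substMap (𝟙 A.P) (operadOne A) ≫ operadMul A = inv (substRight A.P)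
    exact IsIso.eq_inv_of_hom_inv_id (operadMul_one A)
  mul_assoc := operadMul_assoc A

/-- The operad of the monoid of an operad is the original one. -/
noncomputable def monToOperadOperadMonObj :
    monToOperad.obj (@Mon.mk _ _ _ A.P (operadMonObj A)) ≅ A where
  hom := ⟨𝟙 A.P, act_refl A.P A.one, operadMul_std A⟩
  inv := ⟨𝟙 A.P, (act_refl A.P A.one).symm, fun k x y => (operadMul_std A k x y).symm⟩
  hom_inv_id := SymOperad.Hom.ext (Category.id_comp _)
  inv_hom_id := SymOperad.Hom.ext (Category.id_comp _)

end SymOperad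

instance : monToOperad.{w}.EssSurj where
  mem_essImage A := ⟨_, ⟨monToOperadOperadMonObj A⟩⟩

instance : monToOperad.{w}.IsEquivalence where

end SymColl

/-- The fibrewise trivial morphisms of the operadic category `𝒮` are the bijections. `Coll_𝒮` is a
skew monoidal category and `[ℙ, Set]`, with substitution, is a monoidal category; `Coll_𝒮` has a
right normalization, and any right normalization of it is a monoidal category, monoidally equivalent
to `[ℙ, Set]` (compatibly with underlying families of sets). The category of monoids in it is
equivalent to the category of symmetric operads (compatibly with underlying symmetric
collections). -/
theorem mainTheorem4 :
    (∀ {c d : FinCard} (φ : c ⟶ d), FibrewiseTrivial φ ↔ Function.Bijective (FinCard.fn φ)) ∧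
    ∃ (h : (Coll.{w} FinCard).IsSkewMonoidal) (hP : SymColl.substitution.{w}.IsMonoidal),
      Nonempty ((Coll.{w} FinCard).RightNormalization h) ∧
      ∀ N : (Coll.{w} FinCard).RightNormalization h, ∃ hN : N.toSkewMonoidalStruct.IsMonoidal,
        letI := hN.monoidalCategory
        letI := hP.monoidalCategory
        ∃ (F : (Coll.{w} FinCard).UnitModule ≌ SymColl.{w})
          (G : Mon ((Coll.{w} FinCard).UnitModule) ≌ SymOperad.{w}),
          Nonempty F.functor.Monoidal ∧
          Nonempty (F.functor ⋙ SymColl.toFamily ≅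
            SkewMonoidalStruct.UnitModule.forget (Coll.{w} FinCard)) ∧
          Nonempty (G.functor ⋙ SymOperad.forget ≅ Mon.forget _ ⋙ F.functor) := by
  refine ⟨FinCard.fibrewiseTrivial_iff_bijective, Coll.isSkewMonoidal,
    SymColl.isMonoidal_substitution, ⟨SymColl.rightNormalization⟩,
    fun N => ⟨SymColl.isMonoidal_normalization N, ?_⟩⟩
  let := (SymColl.isMonoidal_normalization N).monoidalCategory
  let := SymColl.isMonoidal_substitution.{w}.monoidalCategory
  let := SymColl.ofModuleMonoidal N
  have : SymColl.ofModule.{w}.mapMon.EssSurj :=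
    ⟨fun M => Functor.essImage_mapMon.2
      (Functor.EssSurj.mem_essImage (F := SymColl.ofModule) M.X)⟩
  have : SymColl.ofModule.{w}.mapMon.IsEquivalence := {}
  exact ⟨SymColl.ofModule.asEquivalence,
    SymColl.ofModule.mapMon.asEquivalence.trans SymColl.monToOperad.asEquivalence,
    ⟨SymColl.ofModuleMonoidal N⟩, ⟨Iso.refl _⟩, ⟨Iso.refl _⟩⟩
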